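/- Let $d\ge 0$ and let $\mu$ be a probability measure on $\mathbb{R}^d$ with $\int\|x\|^8\,d\mu(x)<\infty$; put $x^*=\int x\,d\mu(x)$. Let $F:\mathbb{R}^d\to\mathbb{R}$ be convex and four times differentiable with bounded fourth derivative. Let $$(M_2)^{ab}=\int (x-x^*)^a(x-x^*)^b\,d\mu,\qquad (M_4)^{abce}=\int (x-x^*)^a(x-x^*)^b(x-x^*)^c(x-x^*)^e\,d\mu$$ be the second and fourth centred moment tensors of $\mu$, and put (summing over repeated indices from $1$ to $d$) $$\sigma_1=\partial_aF(x^*)\,\partial_bF(x^*)\,(M_2)^{ab},\qquad \sigma_2=\partial^2_{ab}F(x^*)\,(M_2)^{ab},$$ $$\sigma_3=\partial_aF(x^*)\,(M_2)^{ab}\,\partial^3_{bce}F(x^*)\,(M_2)^{ce},\qquad \sigma_4=\partial^2_{ab}F(x^*)\,\partial^2_{ce}F(x^*)\,(M_4)^{abce}.$$ For positive integers $n,K$ let $x_1,\dots,x_n$ be i.i.d. with law $\mu$ and $\bar x=\frac1n\sum_{i=1}^n x_i$. Given $x_1,\dots,x_n$, let $x_{k,i}$ ($1\le k\le K$, $1\le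 i\le n$) be i.i.d. from the empirical distribution of $x_1,\dots,x_n$, let $\tilde x_k=\frac1n\sum_{i=1}^n x_{k,i}$, and define the bootstrap shift $$\hat c=F(\bar x)-\frac1K\sum_{k=1}^K F(\tilde x_k).$$ Let $C_K>0$ be a constant such that $$\frac{\sigma_1}{C_K}+\sqrt{\sigma_1\sigma_4}-\sigma_3\le\frac{\sigma_2^2}{4},$$ and suppose $\sigma_2\neq 0$. Then there is an $N$, depending only on $\mu$, $F$ and $C_K$, such that for all $n\ge N$ and all $K\ge C_K n$ both mean squared errors below are finite and $$\mathbb{E}\big(F(\bar x)+\hat c-F(x^*)\big)^2<\mathbb{E}\big(F(\bar x)-F(x^*)\big)^2,$$ where the expectation is over both the sampling of $x_1,\dots,x_n$ and the bootstrap. -/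

import Mathlib

open MeasureTheory ProbabilityTheory

noncomputable section

namespace BootstrapShift

variable {d : ℕ}

/-- The mean `x⋆ = 𝔼_μ x` of a distribution on `ℝᵈ`. -/
def mean (μ : Measure (EuclideanSpace ℝ (Fin d))) : EuclideanSpace ℝ (Fin d) :=
  ∫ x, x ∂μ

/-- The second centred moment tensor `M₂ = 𝔼 (x - x⋆)^{⊗2}`, in coordinates. -/
def M2 (μ : Measure (EuclideanSpace ℝ (Fin d))) (a b : Fin d) : ℝ :=
  ∫ x, (x a - mean μ a) * (x b - mean μ b) ∂μ

/-- The fourth centred moment tensor `M₄ = 𝔼 (x - x⋆)^{⊗4}`, in coordinates. -/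
def M4 (μ : Measure (EuclideanSpace ℝ (Fin d))) (a b c e : Fin d) : ℝ :=
  ∫ x, (x a - mean μ a) * (x b - mean μ b) * (x c - mean μ c) * (x e - mean μ e) ∂μ

/-- The partial derivative `∂^k F(x) / ∂x^{a 0} ⋯ ∂x^{a (k-1)}`. -/
def pd {k : ℕ} (F : EuclideanSpace ℝ (Fin d) → ℝ) (x : EuclideanSpace ℝ (Fin d))
    (a : Fin k → Fin d) : ℝ :=
  iteratedFDeriv ℝ k F x (fun i => EuclideanSpace.single (a i) 1)

/-- `σ₁ = ∂_a F(x⋆) ∂_b F(x⋆) M₂^{ab}`. -/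
def sigma1 (μ : Measure (EuclideanSpace ℝ (Fin d))) (F : EuclideanSpace ℝ (Fin d) → ℝ) : ℝ :=
  ∑ a, ∑ b, pd F (mean μ) ![a] * pd F (mean μ) ![b] * M2 μ a b

/-- `σ₂ = ∂²_{ab} F(x⋆) M₂^{ab}`. -/
def sigma2 (μ : Measure (EuclideanSpace ℝ (Fin d))) (F : EuclideanSpace ℝ (Fin d) → ℝ) : ℝ :=
  ∑ a, ∑ b, pd F (mean μ) ![a, b] * M2 μ a b

/-- `σ₃ = ∂_a F(x⋆) M₂^{ab} ∂³_{bce} F(x⋆) M₂^{ce}`. -/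
def sigma3 (μ : Measure (EuclideanSpace ℝ (Fin d))) (F : EuclideanSpace ℝ (Fin d) → ℝ) : ℝ :=
  ∑ a, ∑ b, ∑ c, ∑ e,
    pd F (mean μ) ![a] * M2 μ a b * pd F (mean μ) ![b, c, e] * M2 μ c e

/-- `σ₄ = ∂²_{ab} F(x⋆) ∂²_{ce} F(x⋆) M₄^{abce}`. -/
def sigma4 (μ : Measure (EuclideanSpace ℝ (Fin d))) (F : EuclideanSpace ℝ (Fin d) → ℝ) : ℝ :=
  ∑ a, ∑ b, ∑ c, ∑ e, pd F (mean μ) ![a, b] * pd F (mean μ) ![c, e] * M4 μ a b c e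

/-- The sample average `x̄ = (1/n) ∑ᵢ xᵢ`. -/
def avg {n : ℕ} (x : Fin n → EuclideanSpace ℝ (Fin d)) : EuclideanSpace ℝ (Fin d) :=
  (n : ℝ)⁻¹ • ∑ i, x i

/-- The bootstrap shift `ĉ = F(x̄) - (1/K) ∑ₖ F(x̃ₖ)`. In round `k` the `i`-th resampled point is
`x_{J k i}`, so that `x̃ₖ = (1/n) ∑ᵢ x_{J k i}`. -/
def shift {n K : ℕ} (F : EuclideanSpace ℝ (Fin d) → ℝ)
    (x : Fin n → EuclideanSpace ℝ (Fin d)) (J : Fin K → Fin n → Fin n) : ℝ :=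
  F (avg x) - (K : ℝ)⁻¹ * ∑ k, F (avg fun i => x (J k i))

/-- The joint law of the sample and of the resampling indices: the points `x₁, …, xₙ` are i.i.d.
with law `μ`, and, independently of them, the `K * n` indices are i.i.d. uniform on the `n` labels.
Given the sample, the resampled points are thus i.i.d. from its empirical distribution. -/
def jointLaw (μ : Measure (EuclideanSpace ℝ (Fin d))) (n K : ℕ) :
    Measure ((Fin n → EuclideanSpace ℝ (Fin d)) × (Fin K → Fin n → Fin n)) :=
  (Measure.pi fun _ : Fin n => μ).prod
    (Measure.pi fun _ : Fin K => Measure.pi fun _ : Fin n => uniformOn (Set.univ : Set (Fin n)))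

end BootstrapShift

end

/-! Let e = F(x̄) − F(x⋆), let J = F(x̃) − F(x̄) be the increment of one resample, and let G be its
mean given the sample (`err`, `jump`, `meanJump`). The corrected error is e minus the average of K
copies of J that are i.i.d. given the sample. Its conditional mean square is therefore (e − G)² +
Var(J | sample)/K, and bounding the variance by the second moment shows that the correction changes
the mean squared error by at most −2𝔼(eG) + 𝔼G² + 𝔼J²/K.

Each term is expanded by replacing F with its cubic Taylor polynomial at x⋆. Put m = Cov(∂_aF
(x−x⋆)^a, ∂²_{ab}F (x−x⋆)^a (x−x⋆)^b). Up to O(n^{-5/2}) one has 𝔼(eG) = n⁻²(σ₂²/4 + (m + σ₃)/2) and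
𝔼G² = n⁻²σ₂²/4, while 𝔼J² = σ₁/n + O(n^{-3/2}). With 1/K ≤ 1/(Cn) the change is at most n⁻²(σ₁/C − m
− σ₃ − σ₂²/4) + O(n^{-5/2}).

The leading coefficient is strictly negative. By Cauchy–Schwarz m² ≤ σ₁(σ₄ − σ₂²), because σ₄ − σ₂²
is the variance of the quadratic form. Since σ₂ ≠ 0, this gives −m < √(σ₁σ₄) when σ₁ > 0; when σ₁ =
0, both m and σ₃ vanish and −σ₂²/4 remains.

Errors are tracked by `LpOrder P p k`: the Lᵖ norm is O(n^{-k/2}). Orders add under Hölder products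
(L⁸·L⁸ ⊂ L⁴, L⁴·L⁴ ⊂ L²), and division by n adds 2. Averages of centred variables have order 1 by an
even-moment inequality for i.i.d. sums, `exists_integral_sum_pow_le`, whose constant does not depend
on the law. It thus applies both to μ and to the empirical law of a frozen sample. Eight moments put
the quartic Taylor remainder in L² with order 4. The expansions are `lpOrder_meanJump_sub`,
`isOrder_integral_err_mul_meanJump`, `isOrder_integral_meanJump_sq` and `isOrder_integral_jump_sq`;
the sign is `leading_coeff_neg`. Samples have size n + 1 throughout, so that 1/(n + 1) is never
degenerate. -/

open MeasureTheory ProbabilityTheory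

noncomputable section

namespace BootstrapShift

/-! ### Cubic Taylor expansion with a quartic remainder -/

section Taylor

theorem sum_fin_one_fun {ι M : Type*} [Fintype ι] [AddCommMonoid M]
    (φ : (Fin 1 → ι) → M) : ∑ r, φ r = ∑ a, φ ![a] := by
  refine Fintype.sum_equiv (Equiv.funUnique (Fin 1) ι) _ _ fun r => ?_
  congr 1
  ext i
  fin_cases i
  rfl

theorem sum_fin_succ_fun {ι M : Type*} [Fintype ι] [AddCommMonoid M] {k : ℕ}
    (φ : (Fin (k + 1) → ι) → M) : ∑ r, φ r = ∑ a, ∑ s : Fin k → ι, φ (Matrix.vecCons a s) := by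
  rw [← Fintype.sum_prod_type']
  refine Fintype.sum_equiv (Fin.consEquiv fun _ => ι).symm _ _ fun r => ?_
  congr 1
  exact (Fin.cons_self_tail r).symm

variable {d : ℕ}

theorem iteratedFDeriv_diag_eq_sum {k : ℕ} (F : EuclideanSpace ℝ (Fin d) → ℝ)
    (x h : EuclideanSpace ℝ (Fin d)) :
    iteratedFDeriv ℝ k F x (fun _ => h) = ∑ r : Fin k → Fin d, pd F x r * ∏ i, h (r i) := by
  have hh : h = ∑ a, h a • EuclideanSpace.single a (1 : ℝ) := by
    ext b
    simp [Finset.sum_apply, Pi.single_apply]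
  conv_lhs => rw [hh]
  rw [ContinuousMultilinearMap.map_sum]
  refine Finset.sum_congr rfl fun r _ => ?_
  rw [ContinuousMultilinearMap.map_smul_univ, smul_eq_mul, mul_comm]
  rfl

theorem hasDerivAt_iteratedFDeriv_line {k : ℕ} {E : Type*} [NormedAddCommGroup E]
    [NormedSpace ℝ E] {F : E → ℝ} (hF : Differentiable ℝ (iteratedFDeriv ℝ k F)) (x h : E) (t : ℝ) :
    HasDerivAt (fun t : ℝ => iteratedFDeriv ℝ k F (x + t • h) (fun _ => h))
      (iteratedFDeriv ℝ (k + 1) F (x + t • h) (fun _ => h)) t := by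
  have h1 : HasDerivAt (fun t : ℝ => x + t • h) h t := by
    simpa using ((hasDerivAt_id t).smul_const h).const_add x
  have h2 := (hF (x + t • h)).hasFDerivAt.comp_hasDerivAt t h1
  have h3 := (ContinuousMultilinearMap.apply ℝ (fun _ : Fin k => E) ℝ
    (fun _ => h)).hasFDerivAt.comp_hasDerivAt t h2
  rw [iteratedFDeriv_succ_apply_left]
  exact h3

/-- Mean value inequality on [0, 1]: passing from a derivative to its primitive keeps the bound.
Applied repeatedly it controls the Taylor remainder without continuity of the fourth derivative. -/
theorem abs_le_of_hasDerivAt_of_abs_le {f f' : ℝ → ℝ} {M : ℝ} (h0 : f 0 = 0)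
    (hf : ∀ t, HasDerivAt f (f' t) t) (hM : ∀ t ∈ Set.Icc (0 : ℝ) 1, |f' t| ≤ M) :
    ∀ t ∈ Set.Icc (0 : ℝ) 1, |f t| ≤ M := by
  intro t ht
  have h := Convex.norm_image_sub_le_of_norm_hasDerivWithin_le (f := f) (f' := f') (C := M)
    (s := Set.Icc (0 : ℝ) 1) (x := 0) (y := t) (fun x _ => (hf x).hasDerivWithinAt)
    (fun x hx => by simpa using hM x hx) (convex_Icc 0 1) (by simp) ht
  rw [h0, sub_zero, sub_zero, Real.norm_eq_abs, Real.norm_eq_abs] at h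
  have hM0 : 0 ≤ M := (abs_nonneg _).trans (hM t ht)
  have ht1 : |t| ≤ 1 := abs_le.2 ⟨by linarith [ht.1], ht.2⟩
  nlinarith

/-- Restrict F to the segment from x to x + h and descend from the fourth derivative by four mean
value inequalities. The factor 1/24 is lost, which is harmless since only the power of ‖h‖ matters.
-/
theorem abs_sub_cubicTaylor_le {E : Type*} [NormedAddCommGroup E] [NormedSpace ℝ E] {F : E → ℝ}
    (hF3 : ContDiff ℝ 3 F) (hF4 : Differentiable ℝ (iteratedFDeriv ℝ 3 F)) {B : ℝ}
    (hB : ∀ x, ‖iteratedFDeriv ℝ 4 F x‖ ≤ B) (x h : E) :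
    |F (x + h) - F x - iteratedFDeriv ℝ 1 F x (fun _ => h)
      - 2⁻¹ * iteratedFDeriv ℝ 2 F x (fun _ => h) - 6⁻¹ * iteratedFDeriv ℝ 3 F x (fun _ => h)|
      ≤ B * ‖h‖ ^ 4 := by
  set D : ∀ k : ℕ, ℝ → ℝ := fun k t => iteratedFDeriv ℝ k F (x + t • h) (fun _ => h) with hDdef
  have hD : ∀ k ≤ 3, ∀ t, HasDerivAt (D k) (D (k + 1) t) t := by
    intro k hk t
    apply hasDerivAt_iteratedFDeriv_line
    rcases hk.lt_or_eq with hk | rfl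
    · exact hF3.differentiable_iteratedFDeriv (by exact_mod_cast hk)
    · exact hF4
  have b4 : ∀ t ∈ Set.Icc (0 : ℝ) 1, |D 4 t| ≤ B * ‖h‖ ^ 4 := by
    intro t _
    have h1 := (iteratedFDeriv ℝ 4 F (x + t • h)).le_opNorm (fun _ => h)
    rw [Finset.prod_const, Finset.card_univ, Fintype.card_fin] at h1
    exact h1.trans (by gcongr; exact hB _)
  have b3 := abs_le_of_hasDerivAt_of_abs_le (f := fun t => D 3 t - D 3 0) (by simp)
    (fun t => (hD 3 le_rfl t).sub_const _) b4
  have b2 := abs_le_of_hasDerivAt_of_abs_le (f := fun t => D 2 t - D 2 0 - t * D 3 0)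
    (f' := fun t => D 3 t - D 3 0) (by simp)
    (fun t => by
      have := ((hD 2 (by norm_num) t).sub_const (D 2 0)).sub
        ((hasDerivAt_id t).mul_const (D 3 0))
      convert! this using 1
      ring) b3
  have b1 := abs_le_of_hasDerivAt_of_abs_le
    (f := fun t => D 1 t - D 1 0 - t * D 2 0 - t ^ 2 / 2 * D 3 0)
    (f' := fun t => D 2 t - D 2 0 - t * D 3 0) (by simp)
    (fun t => by
      have := (((hD 1 (by norm_num) t).sub_const (D 1 0)).sub
        ((hasDerivAt_id t).mul_const (D 2 0))).sub
          ((((hasDerivAt_id t).pow 2).div_const 2).mul_const (D 3 0))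
      convert! this using 1
      simp only [id]
      norm_num) b2
  have b0 := abs_le_of_hasDerivAt_of_abs_le
    (f := fun t => D 0 t - D 0 0 - t * D 1 0 - t ^ 2 / 2 * D 2 0 - t ^ 3 / 6 * D 3 0)
    (f' := fun t => D 1 t - D 1 0 - t * D 2 0 - t ^ 2 / 2 * D 3 0) (by simp)
    (fun t => by
      have := ((((hD 0 (by norm_num) t).sub_const (D 0 0)).sub
        ((hasDerivAt_id t).mul_const (D 1 0))).sub
          ((((hasDerivAt_id t).pow 2).div_const 2).mul_const (D 2 0))).sub
          ((((hasDerivAt_id t).pow 3).div_const 6).mul_const (D 3 0))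
      convert! this using 1
      simp only [id]
      norm_num
      exact Or.inl (by ring)) b1
  have := b0 1 (by simp)
  simp only [hDdef] at this
  simp only [zero_smul, add_zero, one_smul, iteratedFDeriv_zero_apply] at this
  convert! this using 2
  ring

/-- The third derivative is the derivative of the second, which is symmetric at every point. -/
theorem pd_three_swap_right {F : EuclideanSpace ℝ (Fin d) → ℝ} (hF : ContDiff ℝ 3 F)
    (x : EuclideanSpace ℝ (Fin d)) (a b c : Fin d) : pd F x ![a, b, c] = pd F x ![a, c, b] := by
  have hdiff : Differentiable ℝ (iteratedFDeriv ℝ 2 F) :=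
    hF.differentiable_iteratedFDeriv (by norm_num)
  have key : ∀ (v : EuclideanSpace ℝ (Fin d)) (m : Fin 2 → EuclideanSpace ℝ (Fin d)),
      fderiv ℝ (iteratedFDeriv ℝ 2 F) x v m = fderiv ℝ (fun z => iteratedFDeriv ℝ 2 F z m) x v := by
    intro v m
    have h3 := (ContinuousMultilinearMap.apply ℝ (fun _ : Fin 2 => EuclideanSpace ℝ (Fin d)) ℝ
      m).hasFDerivAt.comp x (hdiff x).hasFDerivAt
    have := h3.fderiv
    have h4 : fderiv ℝ (fun z => iteratedFDeriv ℝ 2 F z m) x = _ := this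
    rw [h4]
    rfl
  unfold pd
  rw [iteratedFDeriv_succ_apply_left, iteratedFDeriv_succ_apply_left, key, key]
  congr 2
  funext z
  have hs := (hF.contDiffAt (x := z)).isSymmSndFDerivAt (by simp; norm_num)
  rw [iteratedFDeriv_two_apply, iteratedFDeriv_two_apply]
  exact hs _ _

/-- Here the third derivative is read as the second derivative of `fderiv ℝ F`, symmetric in its two
outer directions. With the other transposition this gives full symmetry. -/
theorem pd_three_swap_left {F : EuclideanSpace ℝ (Fin d) → ℝ} (hF : ContDiff ℝ 3 F)
    (x : EuclideanSpace ℝ (Fin d)) (a b c : Fin d) : pd F x ![a, b, c] = pd F x ![b, a, c] := by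
  have h2 : ContDiff ℝ 2 (fderiv ℝ F) := hF.fderiv_right (by norm_num)
  unfold pd
  rw [iteratedFDeriv_succ_apply_right (n := 2), iteratedFDeriv_succ_apply_right (n := 2)]
  have hs := (h2.contDiffAt (x := x)).isSymmSndFDerivAt (by simp)
  rw [iteratedFDeriv_two_apply, iteratedFDeriv_two_apply]
  have := hs (EuclideanSpace.single a (1 : ℝ)) (EuclideanSpace.single b 1)
  exact congrArg (fun L => L (EuclideanSpace.single c (1 : ℝ))) this

theorem exists_cubic_expansion {F : EuclideanSpace ℝ (Fin d) → ℝ}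
    (hF3 : ContDiff ℝ 3 F) (hF4 : Differentiable ℝ (iteratedFDeriv ℝ 3 F))
    (hB : ∃ B : ℝ, ∀ x, ‖iteratedFDeriv ℝ 4 F x‖ ≤ B) (x : EuclideanSpace ℝ (Fin d)) :
    ∃ B : ℝ, ∀ h : EuclideanSpace ℝ (Fin d),
      |F (x + h) - (F x + ∑ a, pd F x ![a] * h a + 2⁻¹ * ∑ a, ∑ b, pd F x ![a, b] * (h a * h b)
        + 6⁻¹ * ∑ a, ∑ b, ∑ c, pd F x ![a, b, c] * (h a * h b * h c))| ≤ B * ‖h‖ ^ 4 := by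
  obtain ⟨B, hB⟩ := hB
  refine ⟨B, fun h => ?_⟩
  have := abs_sub_cubicTaylor_le hF3 hF4 hB x h
  simp only [iteratedFDeriv_diag_eq_sum] at this
  rw [sum_fin_one_fun] at this
  simp only [sum_fin_succ_fun (k := 1), sum_fin_succ_fun (k := 2),
    sum_fin_one_fun, Fin.prod_univ_succ] at this
  convert! this using 2
  simp [mul_assoc]
  ring

end Taylor

/-! ### Moments of sums of i.i.d. variables -/

section ProductMoments

universe u

theorem integrable_pow_of_memLp {Ω : Type*} [MeasurableSpace Ω] {ν : Measure Ω}
    [IsFiniteMeasure ν] {f : Ω → ℝ} {p k : ℕ} (hf : MemLp f p ν) (hk : k ≤ p) :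
    Integrable (fun x => f x ^ k) ν := by
  have h := (hf.mono_exponent (p := (k : ENNReal)) (by exact_mod_cast hk)).integrable_norm_pow'
  refine h.mono (hf.1.pow k) (Filter.Eventually.of_forall fun x => ?_)
  simp

variable {Ω : Type u} [MeasurableSpace Ω] {ν : Measure Ω} [IsProbabilityMeasure ν]

theorem memLp_sum_coord {p : ENNReal} {f : Ω → ℝ} (hf : MemLp f p ν) (n : ℕ) :
    MemLp (fun x : Fin n → Ω => ∑ i, f (x i)) p (Measure.pi fun _ => ν) :=
  memLp_finsetSum _ fun i _ => hf.comp_measurePreserving (measurePreserving_eval (fun _ => ν) i)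

theorem integral_pi_succ (n : ℕ) (G : (Fin (n + 1) → Ω) → ℝ) :
    ∫ x, G x ∂(Measure.pi fun _ : Fin (n + 1) => ν)
      = ∫ z, G (Fin.cons z.1 z.2) ∂(ν.prod (Measure.pi fun _ : Fin n => ν)) := by
  have h := measurePreserving_piFinSuccAbove (fun _ : Fin (n + 1) => ν) 0
  rw [← h.integral_comp (MeasurableEquiv.measurableEmbedding _)]
  refine integral_congr_ae (Filter.Eventually.of_forall fun x => ?_)
  congr 1
  exact (Fin.cons_self_tail x).symm

theorem integral_sum_coord {f : Ω → ℝ} (hf : Integrable f ν) (n : ℕ) :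
    ∫ x, ∑ i, f (x i) ∂(Measure.pi fun _ : Fin n => ν) = n * ∫ x, f x ∂ν := by
  rw [integral_finsetSum]
  · have h : ∀ i : Fin n, ∫ x, f (x i) ∂(Measure.pi fun _ : Fin n => ν) = ∫ x, f x ∂ν := fun i =>
      integral_comp_eval (μ := fun _ : Fin n => ν) hf.1
    simp [h]
  · exact fun i _ => integrable_comp_eval (μ := fun _ : Fin n => ν) hf

/-- Split off the first coordinate. By independence one cross term contains ∫ f and the other the
integral of a sum of copies of f, so centring f alone suffices. -/
theorem integral_sum_mul_sum {f g : Ω → ℝ} (hf : MemLp f 2 ν) (hg : MemLp g 2 ν)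
    (hf0 : ∫ x, f x ∂ν = 0) (n : ℕ) :
    ∫ x, (∑ i, f (x i)) * ∑ i, g (x i) ∂(Measure.pi fun _ : Fin n => ν)
      = n * ∫ x, f x * g x ∂ν := by
  induction n with
  | zero => simp
  | succ n ih =>
    have hF := memLp_sum_coord hf n
    have hG := memLp_sum_coord hg n
    have if1 := hf.integrable one_le_two
    have ig1 := hg.integrable one_le_two
    have iF := hF.integrable one_le_two
    have iG := hG.integrable one_le_two
    have e1 := if1.mul_prod iG
    have e2 := ig1.mul_prod iF
    have e3 := (hf.integrable_mul hg).mul_prod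
      (integrable_const (μ := Measure.pi fun _ : Fin n => ν) (1 : ℝ))
    have e4 := (integrable_const (μ := ν) (1 : ℝ)).mul_prod (hF.integrable_mul hG)
    rw [integral_pi_succ]
    simp only [Fin.sum_univ_succ, Fin.cons_zero, Fin.cons_succ]
    rw [integral_congr_ae (g := fun z : Ω × (Fin n → Ω) =>
      (f z.1 * ∑ i, g (z.2 i) + g z.1 * ∑ i, f (z.2 i)) + ((f * g) z.1 * 1 +
        1 * ((fun x : Fin n → Ω => ∑ i, f (x i)) * fun x : Fin n → Ω => ∑ i, g (x i)) z.2))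
      (Filter.Eventually.of_forall fun z => by simp only [Pi.mul_apply]; ring)]
    rw [integral_add (e1.fun_add e2) (e3.fun_add e4), integral_add e1 e2, integral_add e3 e4,
      integral_prod_mul (μ := ν) f (fun x : Fin n → Ω => ∑ i, g (x i)),
      integral_prod_mul (μ := ν) g (fun x : Fin n → Ω => ∑ i, f (x i)),
      integral_prod_mul (μ := ν) (f * g) (fun _ : Fin n → Ω => (1 : ℝ)),
      integral_prod_mul (μ := ν) (fun _ => (1 : ℝ)), integral_sum_coord if1, hf0]
    simp only [Pi.mul_apply, ih]
    simp
    ring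

/-- Every mixed term factors through the mean of a single centred function or sum. Finiteness of Ω
makes all integrability automatic and suffices for resampling labels. -/
theorem integral_sum_mul_sum_mul_sum [Finite Ω] [DiscreteMeasurableSpace Ω] {f g h : Ω → ℝ}
    (hf0 : ∫ x, f x ∂ν = 0) (hg0 : ∫ x, g x ∂ν = 0) (hh0 : ∫ x, h x ∂ν = 0) (n : ℕ) :
    ∫ x, (∑ i, f (x i)) * (∑ i, g (x i)) * (∑ i, h (x i)) ∂(Measure.pi fun _ : Fin n => ν)
      = n * ∫ x, f x * g x * h x ∂ν := by
  induction n with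
  | zero => simp
  | succ n ih =>
    have hs : ∀ φ : Ω → ℝ, ∫ x, φ x ∂ν = 0 →
        ∫ x, ∑ i, φ (x i) ∂(Measure.pi fun _ : Fin n => ν) = 0 := fun φ hφ => by
      rw [integral_sum_coord .of_finite, hφ, mul_zero]
    rw [integral_pi_succ]
    simp only [Fin.sum_univ_succ, Fin.cons_zero, Fin.cons_succ]
    rw [integral_congr_ae (g := fun z : Ω × (Fin n → Ω) =>
      (f z.1 * g z.1 * h z.1) * 1 + (f z.1 * g z.1) * (∑ i, h (z.2 i))
      + (f z.1 * h z.1) * (∑ i, g (z.2 i)) + (g z.1 * h z.1) * (∑ i, f (z.2 i))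
      + f z.1 * ((∑ i, g (z.2 i)) * ∑ i, h (z.2 i)) + g z.1 * ((∑ i, f (z.2 i)) * ∑ i, h (z.2 i))
      + h z.1 * ((∑ i, f (z.2 i)) * ∑ i, g (z.2 i))
      + 1 * ((∑ i, f (z.2 i)) * (∑ i, g (z.2 i)) * ∑ i, h (z.2 i)))
      (Filter.Eventually.of_forall fun z => by ring)]
    rw [integral_add .of_finite .of_finite, integral_add .of_finite .of_finite,
      integral_add .of_finite .of_finite, integral_add .of_finite .of_finite,
      integral_add .of_finite .of_finite, integral_add .of_finite .of_finite,
      integral_add .of_finite .of_finite]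
    rw [integral_prod_mul (μ := ν) (fun x => f x * g x * h x) (fun _ : Fin n → Ω => (1 : ℝ)),
      integral_prod_mul (μ := ν) (fun x => f x * g x) (fun x : Fin n → Ω => ∑ i, h (x i)),
      integral_prod_mul (μ := ν) (fun x => f x * h x) (fun x : Fin n → Ω => ∑ i, g (x i)),
      integral_prod_mul (μ := ν) (fun x => g x * h x) (fun x : Fin n → Ω => ∑ i, f (x i)),
      integral_prod_mul (μ := ν) f
        (fun x : Fin n → Ω => (∑ i, g (x i)) * ∑ i, h (x i)),
      integral_prod_mul (μ := ν) g
        (fun x : Fin n → Ω => (∑ i, f (x i)) * ∑ i, h (x i)),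
      integral_prod_mul (μ := ν) h
        (fun x : Fin n → Ω => (∑ i, f (x i)) * ∑ i, g (x i)),
      integral_prod_mul (μ := ν) (fun _ => (1 : ℝ))
        (fun x : Fin n → Ω => (∑ i, f (x i)) * (∑ i, g (x i)) * ∑ i, h (x i)),
      ih, hs f hf0, hs g hg0, hs h hh0, hf0, hg0, hh0]
    simp
    ring

/-- In the binomial expansion the term linear in x is kept exact, since it will integrate to zero.
In the others x² is factored out and |x|^k |s|^(2m−k) is at most the 2m-th power of the larger of
|x|, |s|; the binomial coefficients sum to at most 2^(2m+2). -/
theorem add_pow_even_le (m : ℕ) (x s : ℝ) :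
    (x + s) ^ (2 * m + 2) ≤ s ^ (2 * m + 2) + (2 * m + 2) * (x * s ^ (2 * m + 1))
      + 2 ^ (2 * m + 2) * (x ^ 2 * s ^ (2 * m) + x ^ (2 * m + 2)) := by
  have hterm : ∀ k ∈ Finset.range (2 * m + 1), x ^ (k + 1 + 1) * s ^ (2 * m + 2 - (k + 1 + 1)) *
      ((2 * m + 2).choose (k + 1 + 1) : ℝ)
      ≤ ((2 * m + 2).choose (k + 1 + 1) : ℝ) * (x ^ 2 * s ^ (2 * m) + x ^ (2 * m + 2)) := by
    intro k hk
    rw [Finset.mem_range] at hk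
    have hm : |x| ^ k * |s| ^ (2 * m - k) ≤ |s| ^ (2 * m) + |x| ^ (2 * m) := by
      have hk' : k + (2 * m - k) = 2 * m := by omega
      have hxp : 0 ≤ |x| ^ (2 * m) := by positivity
      have hsp : 0 ≤ |s| ^ (2 * m) := by positivity
      rcases le_total |x| |s| with h | h
      · calc |x| ^ k * |s| ^ (2 * m - k) ≤ |s| ^ k * |s| ^ (2 * m - k) := by gcongr
          _ = |s| ^ (2 * m) := by rw [← pow_add, hk']
          _ ≤ _ := by linarith
      · calc |x| ^ k * |s| ^ (2 * m - k) ≤ |x| ^ k * |x| ^ (2 * m - k) := by gcongr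
          _ = |x| ^ (2 * m) := by rw [← pow_add, hk']
          _ ≤ _ := by linarith
    rw [(even_two_mul m).pow_abs, (even_two_mul m).pow_abs] at hm
    have he : 2 * m + 2 - (k + 1 + 1) = 2 * m - k := by omega
    rw [he, mul_comm]
    refine mul_le_mul_of_nonneg_left ?_ (by positivity)
    calc x ^ (k + 1 + 1) * s ^ (2 * m - k) ≤ |x ^ (k + 1 + 1) * s ^ (2 * m - k)| := le_abs_self _
      _ = |x| ^ 2 * (|x| ^ k * |s| ^ (2 * m - k)) := by rw [abs_mul, abs_pow, abs_pow]; ring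
      _ ≤ |x| ^ 2 * (s ^ (2 * m) + x ^ (2 * m)) := by gcongr
      _ = _ := by rw [sq_abs]; ring
  have hsum := Finset.sum_le_sum hterm
  rw [← Finset.sum_mul] at hsum
  have hch : ∑ k ∈ Finset.range (2 * m + 1), ((2 * m + 2).choose (k + 1 + 1) : ℝ)
      ≤ 2 ^ (2 * m + 2) := by
    have := Nat.sum_range_choose (2 * m + 2)
    rw [Finset.sum_range_succ', Finset.sum_range_succ'] at this
    have h2 : ∑ k ∈ Finset.range (2 * m + 1), (2 * m + 2).choose (k + 1 + 1) ≤ 2 ^ (2 * m + 2) := by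
      omega
    exact_mod_cast h2
  have hnn : 0 ≤ x ^ 2 * s ^ (2 * m) + x ^ (2 * m + 2) := by
    have h1 := (even_two_mul m).pow_nonneg s
    have h2 := (even_two_mul (m + 1)).pow_nonneg x
    have h3 : 0 ≤ x ^ (2 * m + 2) := h2
    positivity
  rw [add_pow, Finset.sum_range_succ', Finset.sum_range_succ']
  have := hsum.trans (mul_le_mul_of_nonneg_right hch hnn)
  simp only [zero_add, Nat.choose_one_right, Nat.choose_zero_right, pow_zero, pow_one, Nat.sub_zero,
    one_mul, Nat.cast_one, mul_one, Nat.reduceSubDiff] at this ⊢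
  push_cast
  nlinarith [this]

/-- Chebyshev's association inequality: f² and f^(2m) are increasing in |f|, so the product of their
differences at two independent points is nonnegative. Integrate it over ν ⊗ ν. -/
theorem integral_pow_mul_integral_sq_le {m : ℕ} {f : Ω → ℝ} (hf : MemLp f ((2 * m + 2 : ℕ)) ν) :
    (∫ x, f x ^ 2 ∂ν) * (∫ x, f x ^ (2 * m) ∂ν) ≤ ∫ x, f x ^ (2 * m + 2) ∂ν := by
  have i1 := integrable_pow_of_memLp hf (k := 2) (by omega)
  have i2 := integrable_pow_of_memLp hf (k := 2 * m) (by omega)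
  have i3 := integrable_pow_of_memLp hf (k := 2 * m + 2) le_rfl
  have ic := integrable_const (μ := ν) (1 : ℝ)
  have k1 : Integrable (fun z : Ω × Ω => f z.1 ^ (2 * m + 2) * 1 + 1 * f z.2 ^ (2 * m + 2))
      (ν.prod ν) := (i3.mul_prod ic).add (ic.mul_prod i3)
  have k2 : Integrable (fun z : Ω × Ω => f z.1 ^ 2 * f z.2 ^ (2 * m) + f z.1 ^ (2 * m) * f z.2 ^ 2)
      (ν.prod ν) := (i1.mul_prod i2).add (i2.mul_prod i1)
  have hnn : 0 ≤ ∫ z, (f z.1 ^ 2 - f z.2 ^ 2) * (f z.1 ^ (2 * m) - f z.2 ^ (2 * m)) ∂(ν.prod ν) := by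
    refine integral_nonneg fun z => ?_
    simp only [pow_mul, Pi.zero_apply]
    rcases le_total (f z.1 ^ 2) (f z.2 ^ 2) with h | h
    · exact mul_nonneg_of_nonpos_of_nonpos (by linarith)
        (sub_nonpos.2 (pow_le_pow_left₀ (sq_nonneg _) h m))
    · exact mul_nonneg (by linarith) (sub_nonneg.2 (pow_le_pow_left₀ (sq_nonneg _) h m))
  rw [integral_congr_ae (g := fun z : Ω × Ω => (f z.1 ^ (2 * m + 2) * 1 + 1 * f z.2 ^ (2 * m + 2))
      - (f z.1 ^ 2 * f z.2 ^ (2 * m) + f z.1 ^ (2 * m) * f z.2 ^ 2))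
      (Filter.Eventually.of_forall fun z => by ring)] at hnn
  rw [integral_sub k1 k2,
    integral_add (i3.mul_prod ic) (ic.mul_prod i3), integral_add (i1.mul_prod i2) (i2.mul_prod i1),
    integral_prod_mul (fun x => f x ^ (2 * m + 2)) (fun _ => (1 : ℝ)),
    integral_prod_mul (fun _ => (1 : ℝ)) (fun x => f x ^ (2 * m + 2)),
    integral_prod_mul (fun x => f x ^ 2) (fun x => f x ^ (2 * m)),
    integral_prod_mul (fun x => f x ^ (2 * m)) (fun x => f x ^ 2)] at hnn
  simp at hnn
  nlinarith

/-- Adding one variable raises the moment of order 2m + 2 by at most a multiple of n^m, by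
`add_pow_even_le` and the bound for exponent 2m; summing over n gives n^(m+1). The constant is
chosen before the space and the law, as needed for random empirical laws. -/
theorem exists_integral_sum_pow_le (m : ℕ) : ∃ c : ℝ, 0 ≤ c ∧ ∀ (Ω : Type u) [MeasurableSpace Ω]
    (ν : Measure Ω) [IsProbabilityMeasure ν] (f : Ω → ℝ), MemLp f ((2 * m : ℕ)) ν →
    ∫ x, f x ∂ν = 0 → ∀ n : ℕ,
      ∫ x, (∑ i, f (x i)) ^ (2 * m) ∂(Measure.pi fun _ : Fin n => ν)
        ≤ c * (n : ℝ) ^ m * ∫ x, f x ^ (2 * m) ∂ν := by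
  induction m with
  | zero => exact ⟨1, zero_le_one, fun Ω _ ν _ f _ _ n => by simp⟩
  | succ m ih =>
    obtain ⟨c, hc, ih⟩ := ih
    -- In c + 1, the c comes from the terms x² s^(2m) through the inductive bound, and the 1 from
    -- x^(2m+2).
    refine ⟨2 ^ (2 * m + 2) * (c + 1), by positivity, fun Ω _ ν _ f hf hf0 n => ?_⟩
    have hf' : MemLp f ((2 * m + 2 : ℕ)) ν := hf
    have hlow : MemLp f ((2 * m : ℕ)) ν := hf'.mono_exponent (by norm_cast; omega)
    set M := ∫ x, f x ^ (2 * m + 2) ∂ν with hM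
    have hM0 : 0 ≤ M := integral_nonneg fun x => (even_two_mul (m + 1)).pow_nonneg (f x)
    change ∫ x, (∑ i, f (x i)) ^ (2 * m + 2) ∂(Measure.pi fun _ : Fin n => ν) ≤ _ * _ * M
    induction n with
    | zero => simp
    | succ n ihn =>
      have hS := memLp_sum_coord hf' n
      have ic := integrable_const (μ := ν) (1 : ℝ)
      have ic' := integrable_const (μ := Measure.pi fun _ : Fin n => ν) (1 : ℝ)
      have s0 := integrable_pow_of_memLp hS (k := 2 * m + 2) le_rfl
      have s1 := integrable_pow_of_memLp hS (k := 2 * m + 1) (by omega)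
      have s2 := integrable_pow_of_memLp hS (k := 2 * m) (by omega)
      have f0 := integrable_pow_of_memLp hf' (k := 2 * m + 2) le_rfl
      have f1 : Integrable f ν := by
        simpa using integrable_pow_of_memLp hf' (k := 1) (by omega)
      have f2 := integrable_pow_of_memLp hf' (k := 2) (by omega)
      have j1 := ic.mul_prod s0
      have j2 := (f1.mul_prod s1).const_mul (2 * m + 2 : ℝ)
      have j3 := f2.mul_prod s2
      have j4 := f0.mul_prod ic'
      rw [integral_pi_succ]
      simp only [Fin.sum_univ_succ, Fin.cons_zero, Fin.cons_succ]
      have hle : ∫ z, (f z.1 + ∑ i, f (z.2 i)) ^ (2 * m + 2)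
            ∂(ν.prod (Measure.pi fun _ : Fin n => ν))
          ≤ ∫ z, (1 * (∑ i, f (z.2 i)) ^ (2 * m + 2)
            + (2 * m + 2) * (f z.1 * (∑ i, f (z.2 i)) ^ (2 * m + 1)))
            + 2 ^ (2 * m + 2) * (f z.1 ^ 2 * (∑ i, f (z.2 i)) ^ (2 * m) + f z.1 ^ (2 * m + 2) * 1)
            ∂(ν.prod (Measure.pi fun _ : Fin n => ν)) := by
        refine integral_mono_of_nonneg (Filter.Eventually.of_forall fun z =>
          (even_two_mul (m + 1)).pow_nonneg _) ((j1.add j2).add ((j3.add j4).const_mul _))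
          (Filter.Eventually.of_forall fun z => ?_)
        simpa only [one_mul, mul_one] using add_pow_even_le m (f z.1) (∑ i, f (z.2 i))
      refine hle.trans ?_
      rw [integral_add (j1.fun_add j2) ((j3.fun_add j4).const_mul _), integral_add j1 j2,
        integral_const_mul (2 * m + 2 : ℝ), integral_const_mul (2 ^ (2 * m + 2) : ℝ),
        integral_add j3 j4,
        integral_prod_mul (μ := ν) (fun _ => (1 : ℝ))
          (fun x : Fin n → Ω => (∑ i, f (x i)) ^ (2 * m + 2)),
        integral_prod_mul (μ := ν) f (fun x : Fin n → Ω => (∑ i, f (x i)) ^ (2 * m + 1)),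
        integral_prod_mul (μ := ν) (fun x => f x ^ 2)
          (fun x : Fin n → Ω => (∑ i, f (x i)) ^ (2 * m)),
        integral_prod_mul (μ := ν) (fun x => f x ^ (2 * m + 2)) (fun _ : Fin n → Ω => (1 : ℝ)),
        hf0, ← hM]
      have h1 := ih Ω ν f hlow hf0 n
      have h2 := integral_pow_mul_integral_sq_le hf'
      have hf2 : 0 ≤ ∫ x, f x ^ 2 ∂ν := integral_nonneg fun x => sq_nonneg _
      have h3 : (∫ x, f x ^ 2 ∂ν) * ∫ x, (∑ i, f (x i)) ^ (2 * m) ∂(Measure.pi fun _ : Fin n => ν)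
          ≤ c * (n : ℝ) ^ m * M := by
        calc _ ≤ (∫ x, f x ^ 2 ∂ν) * (c * (n : ℝ) ^ m * ∫ x, f x ^ (2 * m) ∂ν) := by gcongr
          _ = c * (n : ℝ) ^ m * ((∫ x, f x ^ 2 ∂ν) * ∫ x, f x ^ (2 * m) ∂ν) := by ring
          _ ≤ _ := by gcongr
      simp only [integral_const, probReal_univ, smul_eq_mul, mul_one, one_mul, zero_mul, mul_zero,
        add_zero]
      have hA : (0 : ℝ) ≤ 2 ^ (2 * m + 2) := by positivity
      have hpow : (n : ℝ) ^ m ≤ ((n : ℝ) + 1) ^ m := by gcongr; linarith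
      have hone : (1 : ℝ) ≤ ((n : ℝ) + 1) ^ m := one_le_pow₀ (by linarith [n.cast_nonneg (α := ℝ)])
      push_cast
      calc _ ≤ 2 ^ (2 * m + 2) * (c + 1) * (n : ℝ) ^ (m + 1) * M
            + 2 ^ (2 * m + 2) * (c * (n : ℝ) ^ m * M + M) := by gcongr
        _ = 2 ^ (2 * m + 2) * M * ((c + 1) * ((n : ℝ) ^ m * n) + (c * (n : ℝ) ^ m + 1)) := by ring
        _ ≤ 2 ^ (2 * m + 2) * M * ((c + 1) * (((n : ℝ) + 1) ^ m * n)
            + (c * ((n : ℝ) + 1) ^ m + ((n : ℝ) + 1) ^ m)) := by gcongr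
        _ = _ := by ring

end ProductMoments

/-! ### Calculus of Lᵖ orders in powers of n^{-1/2} -/

section LpOrder

theorem holderTriple_eight : ENNReal.HolderTriple 8 8 4 := ⟨by
  have h : (8 : ENNReal) = 4 * 2 := by norm_num
  rw [h, ENNReal.mul_inv (by simp) (by simp), ← mul_add, ENNReal.inv_two_add_inv_two, mul_one]⟩

theorem holderTriple_four : ENNReal.HolderTriple 4 4 2 := ⟨by
  have h : (4 : ENNReal) = 2 * 2 := by norm_num
  rw [h, ENNReal.mul_inv (by simp) (by simp), ← mul_add, ENNReal.inv_two_add_inv_two, mul_one]⟩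

theorem lpNorm_pow_two_mul {Ω : Type*} [MeasurableSpace Ω] {ν : Measure Ω} {f : Ω → ℝ} {m : ℕ}
    (hm : m ≠ 0) (hf : MemLp f ((2 * m : ℕ)) ν) :
    lpNorm f ((2 * m : ℕ)) ν ^ (2 * m) = ∫ x, f x ^ (2 * m) ∂ν := by
  have h0 : (2 * m : ℕ) ≠ 0 := by omega
  rw [lpNorm_eq_integral_norm_rpow_toReal (by exact_mod_cast h0) (ENNReal.natCast_ne_top _) hf.1]
  have hnn : 0 ≤ ∫ x, ‖f x‖ ^ (((2 * m : ℕ) : ENNReal).toReal) ∂ν :=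
    integral_nonneg fun x => by positivity
  rw [ENNReal.toReal_natCast] at hnn ⊢
  rw [Real.rpow_inv_natCast_pow hnn h0]
  simp only [Real.rpow_natCast, Real.norm_eq_abs, (even_two_mul m).pow_abs]

theorem lpNorm_le_of_integral_pow_le {Ω : Type*} [MeasurableSpace Ω] {ν : Measure Ω} {f : Ω → ℝ}
    {m : ℕ} (hm : m ≠ 0) (hf : MemLp f ((2 * m : ℕ)) ν) {a : ℝ} (ha : 0 ≤ a)
    (h : ∫ x, f x ^ (2 * m) ∂ν ≤ a ^ (2 * m)) : lpNorm f ((2 * m : ℕ)) ν ≤ a := by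
  rw [← lpNorm_pow_two_mul hm hf] at h
  exact le_of_pow_le_pow_left₀ (by omega) ha h

theorem lpNorm_mul_le {Ω : Type*} [MeasurableSpace Ω] {ν : Measure Ω} {f g : Ω → ℝ}
    {p q r : ENNReal} [ENNReal.HolderTriple p q r] (hf : MemLp f p ν) (hg : MemLp g q ν) :
    lpNorm (fun x => f x * g x) r ν ≤ lpNorm f p ν * lpNorm g q ν := by
  have h := eLpNorm_smul_le_mul_eLpNorm (p := p) (q := q) (r := r) hg.1 hf.1
  have hm : AEStronglyMeasurable (fun x => f x * g x) ν := hf.1.mul hg.1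
  rw [← toReal_eLpNorm hm, ← toReal_eLpNorm hf.1, ← toReal_eLpNorm hg.1, ← ENNReal.toReal_mul]
  exact ENNReal.toReal_mono (ENNReal.mul_ne_top hf.2.ne hg.2.ne) h

theorem lpNorm_mono_exponent {Ω : Type*} [MeasurableSpace Ω] {ν : Measure Ω}
    [IsProbabilityMeasure ν] {f : Ω → ℝ} {p q : ENNReal} (hf : MemLp f q ν) (hpq : p ≤ q) :
    lpNorm f p ν ≤ lpNorm f q ν := by
  rw [← toReal_eLpNorm hf.1, ← toReal_eLpNorm hf.1]
  exact ENNReal.toReal_mono hf.2.ne (eLpNorm_le_eLpNorm_of_exponent_le hpq hf.1)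

theorem lpNorm_comp_measurePreserving {Ω Ω' : Type*} [MeasurableSpace Ω] [MeasurableSpace Ω']
    {ν : Measure Ω} {ν' : Measure Ω'} {f : Ω' → ℝ} {φ : Ω → Ω'} {p : ENNReal}
    (hf : AEStronglyMeasurable f ν') (hφ : MeasurePreserving φ ν ν') :
    lpNorm (fun x => f (φ x)) p ν = lpNorm f p ν' := by
  have h : AEStronglyMeasurable (fun x => f (φ x)) ν := hf.comp_measurePreserving hφ
  rw [← toReal_eLpNorm h, ← toReal_eLpNorm hf]
  exact congrArg _ (eLpNorm_comp_measurePreserving hf hφ)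

/-- The scale `1 / √(n + 1)` of a sample of size `n + 1`. -/
def scale (n : ℕ) : ℝ := (√(n + 1))⁻¹

theorem scale_pos (n : ℕ) : 0 < scale n := by unfold scale; positivity

theorem scale_le_one (n : ℕ) : scale n ≤ 1 := by
  unfold scale
  refine inv_le_one_of_one_le₀ (Real.one_le_sqrt.2 ?_)
  linarith [n.cast_nonneg (α := ℝ)]

theorem scale_sq (n : ℕ) : scale n ^ 2 = ((n : ℝ) + 1)⁻¹ := by
  unfold scale
  rw [inv_pow, Real.sq_sqrt (by positivity)]

theorem tendsto_scale : Filter.Tendsto scale Filter.atTop (nhds 0) := by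
  refine Filter.Tendsto.inv_tendsto_atTop (Real.tendsto_sqrt_atTop.comp ?_)
  exact Filter.tendsto_atTop_add_const_right _ _ tendsto_natCast_atTop_atTop

/-- A real sequence of order `scale ^ k`. -/
def IsOrder (k : ℕ) (r : ℕ → ℝ) : Prop := ∃ c : ℝ, ∀ n, |r n| ≤ c * scale n ^ k

theorem IsOrder.add {k : ℕ} {r s : ℕ → ℝ} (hr : IsOrder k r) (hs : IsOrder k s) :
    IsOrder k fun n => r n + s n := by
  obtain ⟨c, hc⟩ := hr
  obtain ⟨c', hc'⟩ := hs
  exact ⟨c + c', fun n => (abs_add_le _ _).trans (by linarith [hc n, hc' n])⟩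

theorem IsOrder.const_mul {k : ℕ} {r : ℕ → ℝ} (a : ℝ) (hr : IsOrder k r) :
    IsOrder k fun n => a * r n := by
  obtain ⟨c, hc⟩ := hr
  refine ⟨|a| * c, fun n => ?_⟩
  rw [abs_mul, mul_assoc]
  exact mul_le_mul_of_nonneg_left (hc n) (abs_nonneg a)

theorem IsOrder.inv_mul {k : ℕ} {r : ℕ → ℝ} (hr : IsOrder k r) :
    IsOrder (k + 2) fun n => ((n : ℝ) + 1)⁻¹ * r n := by
  obtain ⟨c, hc⟩ := hr
  refine ⟨c, fun n => ?_⟩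
  beta_reduce
  rw [← scale_sq, abs_mul, abs_of_nonneg (sq_nonneg _)]
  calc scale n ^ 2 * |r n| ≤ scale n ^ 2 * (c * scale n ^ k) :=
        mul_le_mul_of_nonneg_left (hc n) (sq_nonneg _)
    _ = c * scale n ^ (k + 2) := by ring

theorem IsOrder.neg {k : ℕ} {r : ℕ → ℝ} (hr : IsOrder k r) : IsOrder k fun n => -r n := by
  simpa using hr.const_mul (-1)

theorem IsOrder.sub {k : ℕ} {r s : ℕ → ℝ} (hr : IsOrder k r) (hs : IsOrder k s) :
    IsOrder k fun n => r n - s n := by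
  simpa [sub_eq_add_neg] using hr.add hs.neg

/-- A sequence of random variables whose `Lᵖ` norms are of order `scale ^ k`. -/
def LpOrder {Ω : ℕ → Type*} [∀ n, MeasurableSpace (Ω n)] (P : ∀ n, Measure (Ω n)) (p : ENNReal)
    (k : ℕ) (f : ∀ n, Ω n → ℝ) : Prop :=
  ∃ c : ℝ, ∀ n, MemLp (f n) p (P n) ∧ lpNorm (f n) p (P n) ≤ c * scale n ^ k

variable {Ω : ℕ → Type*} [∀ n, MeasurableSpace (Ω n)] {P : ∀ n, Measure (Ω n)}
  {p q r : ENNReal} {k l : ℕ} {f g : ∀ n, Ω n → ℝ}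

theorem LpOrder.memLp (hf : LpOrder P p k f) (n : ℕ) : MemLp (f n) p (P n) := by
  obtain ⟨c, hc⟩ := hf
  exact (hc n).1

theorem LpOrder.exists_nonneg (hf : LpOrder P p k f) :
    ∃ c : ℝ, 0 ≤ c ∧ ∀ n, MemLp (f n) p (P n) ∧ lpNorm (f n) p (P n) ≤ c * scale n ^ k := by
  obtain ⟨c, hc⟩ := hf
  refine ⟨|c|, abs_nonneg c, fun n => ⟨(hc n).1, (hc n).2.trans ?_⟩⟩
  exact mul_le_mul_of_nonneg_right (le_abs_self c) (pow_nonneg (scale_pos n).le k)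

theorem LpOrder.add (hp : 1 ≤ p) (hf : LpOrder P p k f) (hg : LpOrder P p k g) :
    LpOrder P p k fun n x => f n x + g n x := by
  obtain ⟨c, hc⟩ := hf
  obtain ⟨c', hc'⟩ := hg
  refine ⟨c + c', fun n => ⟨(hc n).1.add (hc' n).1, ?_⟩⟩
  refine (lpNorm_add_le (hc n).1 hp).trans ?_
  linarith [(hc n).2, (hc' n).2]

theorem LpOrder.const_mul (a : ℝ) (hf : LpOrder P p k f) : LpOrder P p k fun n x => a * f n x := by
  obtain ⟨c, hc⟩ := hf
  refine ⟨|a| * c, fun n => ⟨(hc n).1.const_mul a, ?_⟩⟩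
  have h := lpNorm_const_smul (p := p) a (f n) (P n)
  have h' : lpNorm (fun x => a * f n x) p (P n) = |a| * lpNorm (f n) p (P n) := by
    simpa [Pi.smul_def] using h
  rw [h', mul_assoc]
  exact mul_le_mul_of_nonneg_left (hc n).2 (abs_nonneg a)

theorem LpOrder.neg (hf : LpOrder P p k f) : LpOrder P p k fun n x => -f n x := by
  simpa using hf.const_mul (-1)

theorem LpOrder.sub (hp : 1 ≤ p) (hf : LpOrder P p k f) (hg : LpOrder P p k g) :
    LpOrder P p k fun n x => f n x - g n x := by
  simpa [sub_eq_add_neg] using hf.add hp hg.neg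

theorem LpOrder.inv_mul (hf : LpOrder P p k f) :
    LpOrder P p (k + 2) fun n x => ((n : ℝ) + 1)⁻¹ * f n x := by
  obtain ⟨c, hc⟩ := hf
  refine ⟨c, fun n => ⟨(hc n).1.const_mul _, ?_⟩⟩
  have h := lpNorm_const_smul (p := p) ((n : ℝ) + 1)⁻¹ (f n) (P n)
  have h' : lpNorm (fun x => ((n : ℝ) + 1)⁻¹ * f n x) p (P n)
      = scale n ^ 2 * lpNorm (f n) p (P n) := by
    rw [scale_sq]
    have hn : ‖((n : ℝ) + 1)⁻¹‖₊ = ((n : NNReal) + 1)⁻¹ := by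
      ext
      simp only [coe_nnnorm, Real.norm_eq_abs, NNReal.coe_inv, NNReal.coe_add, NNReal.coe_natCast,
        NNReal.coe_one]
      exact abs_of_nonneg (by positivity)
    rw [hn] at h
    simpa [Pi.smul_def] using h
  rw [h', pow_add]
  nlinarith [mul_le_mul_of_nonneg_left (hc n).2 (sq_nonneg (scale n))]

theorem LpOrder.zero : LpOrder P p k fun _ _ => 0 := ⟨0, fun n => ⟨MemLp.zero, by simp⟩⟩

theorem LpOrder.sum {ι : Type*} (s : Finset ι) (hp : 1 ≤ p) {f : ι → ∀ n, Ω n → ℝ}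
    (hf : ∀ i ∈ s, LpOrder P p k (f i)) : LpOrder P p k fun n x => ∑ i ∈ s, f i n x := by
  classical
  induction s using Finset.induction_on with
  | empty => simpa using LpOrder.zero
  | insert a s ha ih =>
    simp only [Finset.sum_insert ha]
    exact (hf a (Finset.mem_insert_self a s)).add hp
      (ih fun i hi => hf i (Finset.mem_insert_of_mem hi))

theorem LpOrder.mono_order (hf : LpOrder P p l f) (hkl : k ≤ l) : LpOrder P p k f := by
  obtain ⟨c, hc0, hc⟩ := hf.exists_nonneg
  exact ⟨c, fun n => ⟨(hc n).1, (hc n).2.trans (mul_le_mul_of_nonneg_left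
    (pow_le_pow_of_le_one (scale_pos n).le (scale_le_one n) hkl) hc0)⟩⟩

theorem LpOrder.mono_exponent [∀ n, IsProbabilityMeasure (P n)] (hf : LpOrder P q k f)
    (hpq : p ≤ q) : LpOrder P p k f := by
  obtain ⟨c, hc⟩ := hf
  exact ⟨c, fun n => ⟨(hc n).1.mono_exponent hpq,
    (lpNorm_mono_exponent (hc n).1 hpq).trans (hc n).2⟩⟩

theorem LpOrder.mul [ENNReal.HolderTriple p q r] (hf : LpOrder P p k f) (hg : LpOrder P q l g) :
    LpOrder P r (k + l) fun n x => f n x * g n x := by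
  obtain ⟨c, hc0, hc⟩ := hf.exists_nonneg
  obtain ⟨c', hc0', hc'⟩ := hg.exists_nonneg
  refine ⟨c * c', fun n => ⟨(hc' n).1.mul (hc n).1, ?_⟩⟩
  calc lpNorm (fun x => f n x * g n x) r (P n)
      ≤ lpNorm (f n) p (P n) * lpNorm (g n) q (P n) := lpNorm_mul_le (hc n).1 (hc' n).1
    _ ≤ (c * scale n ^ k) * (c' * scale n ^ l) :=
        mul_le_mul (hc n).2 (hc' n).2 lpNorm_nonneg
          (mul_nonneg hc0 (pow_nonneg (scale_pos n).le k))
    _ = c * c' * scale n ^ (k + l) := by ring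

theorem LpOrder.of_abs_le (hg : LpOrder P p k g) (hf : ∀ n, AEStronglyMeasurable (f n) (P n))
    (hfg : ∀ n x, |f n x| ≤ g n x) : LpOrder P p k f := by
  obtain ⟨c, hc⟩ := hg
  refine ⟨c, fun n => ⟨(hc n).1.mono' (hf n) (Filter.Eventually.of_forall (hfg n)), ?_⟩⟩
  exact (lpNorm_mono_real (hc n).1 (hfg n)).trans (hc n).2

theorem LpOrder.abs (hf : LpOrder P p k f) : LpOrder P p k fun n x => |f n x| := by
  obtain ⟨c, hc⟩ := hf
  exact ⟨c, fun n => ⟨(hc n).1.abs, by rw [lpNorm_fun_abs (hc n).1.1]; exact (hc n).2⟩⟩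

theorem LpOrder.const [∀ n, IsProbabilityMeasure (P n)] (hp : p ≠ 0) (a : ℝ) :
    LpOrder P p 0 fun _ _ => a := by
  refine ⟨|a|, fun n => ⟨memLp_const a, ?_⟩⟩
  rw [lpNorm_const hp (IsProbabilityMeasure.ne_zero (P n))]
  simp

theorem LpOrder.comp {Ω' : ℕ → Type*} [∀ n, MeasurableSpace (Ω' n)] {P' : ∀ n, Measure (Ω' n)}
    {φ : ∀ n, Ω' n → Ω n} (hf : LpOrder P p k f) (hφ : ∀ n, MeasurePreserving (φ n) (P' n) (P n)) :
    LpOrder P' p k fun n x => f n (φ n x) := by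
  obtain ⟨c, hc⟩ := hf
  refine ⟨c, fun n => ⟨(hc n).1.comp_measurePreserving (hφ n), ?_⟩⟩
  rw [lpNorm_comp_measurePreserving (hc n).1.1 (hφ n)]
  exact (hc n).2

theorem LpOrder.of_integral_pow_le {m : ℕ} (hm : m ≠ 0)
    (hf : ∀ n, MemLp (f n) ((2 * m : ℕ)) (P n)) {a : ℝ} (ha : 0 ≤ a)
    (h : ∀ n, ∫ x, f n x ^ (2 * m) ∂(P n) ≤ a * scale n ^ (k * (2 * m))) :
    LpOrder P ((2 * m : ℕ)) k f := by
  have h0 : (2 * m : ℕ) ≠ 0 := by omega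
  refine ⟨a ^ (((2 * m : ℕ) : ℝ)⁻¹), fun n => ⟨hf n, ?_⟩⟩
  have hs := (scale_pos n).le
  refine lpNorm_le_of_integral_pow_le hm (hf n) (by positivity) ((h n).trans ?_)
  rw [mul_pow, Real.rpow_inv_natCast_pow ha h0, ← pow_mul]

theorem LpOrder.integral_pow_le {m : ℕ} (hm : m ≠ 0) (hf : LpOrder P ((2 * m : ℕ)) k f) :
    ∃ a : ℝ, 0 ≤ a ∧ ∀ n, ∫ x, f n x ^ (2 * m) ∂(P n) ≤ a * scale n ^ (k * (2 * m)) := by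
  obtain ⟨c, hc0, hc⟩ := hf.exists_nonneg
  refine ⟨c ^ (2 * m), by positivity, fun n => ?_⟩
  rw [← lpNorm_pow_two_mul hm (hc n).1, pow_mul (scale n), ← mul_pow]
  exact pow_le_pow_left₀ lpNorm_nonneg (hc n).2 _

theorem LpOrder.integral (hf : LpOrder P 1 k f) : IsOrder k fun n => ∫ x, f n x ∂(P n) := by
  obtain ⟨c, hc⟩ := hf
  refine ⟨c, fun n => le_trans ?_ (hc n).2⟩
  rw [lpNorm_one_eq_integral_norm (hc n).1.1]
  exact norm_integral_le_integral_norm (f n)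

theorem LpOrder.integral_mul (hf : LpOrder P 2 k f) (hg : LpOrder P 2 l g) :
    IsOrder (k + l) fun n => ∫ x, f n x * g n x ∂(P n) :=
  (hf.mul (r := 1) hg).integral

/-- Conditional Jensen: averaging over the second factor does not increase the L² norm. This carries
bounds on one resample over to its bootstrap mean. -/
theorem LpOrder.integral_snd {Ω' : ℕ → Type*} [∀ n, MeasurableSpace (Ω' n)]
    {Q : ∀ n, Measure (Ω' n)} [∀ n, IsProbabilityMeasure (P n)] [∀ n, IsProbabilityMeasure (Q n)]
    {f : ∀ n, Ω n × Ω' n → ℝ} (hf : LpOrder (fun n => (P n).prod (Q n)) 2 k f) :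
    LpOrder P 2 k fun n x => ∫ y, f n (x, y) ∂(Q n) := by
  obtain ⟨a, ha, h⟩ := LpOrder.integral_pow_le (m := 1) one_ne_zero (by simpa using hf)
  have hm : ∀ n, AEStronglyMeasurable (fun x => ∫ y, f n (x, y) ∂(Q n)) (P n) :=
    fun n => (hf.memLp n).1.integral_prod_right'
  have hsq : ∀ n, Integrable (fun z => f n z ^ 2) ((P n).prod (Q n)) :=
    fun n => (hf.memLp n).integrable_sq
  have hj : ∀ n, ∀ᵐ x ∂(P n), (∫ y, f n (x, y) ∂(Q n)) ^ 2 ≤ ∫ y, f n (x, y) ^ 2 ∂(Q n) := by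
    intro n
    filter_upwards [(hsq n).prod_right_ae, (hf.memLp n).1.prodMk_left] with x hx hx1
    have hx2 : MemLp (fun y => f n (x, y)) 2 (Q n) := (memLp_two_iff_integrable_sq hx1).2 hx
    -- Jensen for the square, in the form of nonnegative variance on the fibre over x.
    have := variance_nonneg (fun y => f n (x, y)) (Q n)
    rw [variance_eq_sub hx2] at this
    simpa using this
  have hi : ∀ n, Integrable (fun x => (∫ y, f n (x, y) ∂(Q n)) ^ 2) (P n) := by
    intro n
    refine (hsq n).integral_prod_left.mono' ((hm n).pow 2) ?_
    filter_upwards [hj n] with x hx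
    rw [Real.norm_eq_abs, abs_of_nonneg (sq_nonneg _)]
    exact hx
  have hmem : ∀ n, MemLp (fun x => ∫ y, f n (x, y) ∂(Q n)) 2 (P n) :=
    fun n => (memLp_two_iff_integrable_sq (hm n)).2 (hi n)
  have := LpOrder.of_integral_pow_le (P := P) (k := k) (m := 1) one_ne_zero
    (f := fun n x => ∫ y, f n (x, y) ∂(Q n)) (by simpa using hmem) ha (fun n => ?_)
  · simpa using this
  · refine le_trans ?_ (h n)
    simp only [mul_one]
    rw [integral_prod _ (hsq n)]
    exact integral_mono_ae (hi n) (hsq n).integral_prod_left (hj n)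

end LpOrder

/-! ### Averages over an i.i.d. sample -/

section Empirical

/-- The average of `φ` over a sample of size `n + 1`. -/
def emp {Ω : Type*} (φ : Ω → ℝ) (n : ℕ) (x : Fin (n + 1) → Ω) : ℝ :=
  ((n : ℝ) + 1)⁻¹ * ∑ i, φ (x i)

/-- The law of an i.i.d. sample of size `n + 1`. -/
def sampleLaw {Ω : Type*} [MeasurableSpace Ω] (ν : Measure Ω) (n : ℕ) :
    Measure (Fin (n + 1) → Ω) :=
  Measure.pi fun _ => ν

variable {Ω : Type*} [MeasurableSpace Ω] {ν : Measure Ω} [IsProbabilityMeasure ν]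

instance isProbabilityMeasure_sampleLaw (n : ℕ) : IsProbabilityMeasure (sampleLaw ν n) := by
  unfold sampleLaw
  infer_instance

theorem memLp_emp {p : ENNReal} {φ : Ω → ℝ} (hφ : MemLp φ p ν) (n : ℕ) :
    MemLp (emp φ n) p (sampleLaw ν n) :=
  (memLp_sum_coord hφ (n + 1)).const_mul _

/-- Triangle inequality only: without centring there is no decay. -/
theorem lpOrder_emp {p : ENNReal} (hp : 1 ≤ p) {φ : Ω → ℝ} (hφ : MemLp φ p ν) :
    LpOrder (sampleLaw ν) p 0 (emp φ) := by
  refine ⟨lpNorm φ p ν, fun n => ⟨memLp_emp hφ n, ?_⟩⟩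
  have hev : ∀ i : Fin (n + 1), MeasurePreserving (fun x : Fin (n + 1) → Ω => x i)
      (sampleLaw ν n) ν := fun i => measurePreserving_eval (fun _ : Fin (n + 1) => ν) i
  have h1 := lpNorm_sum_le (μ := sampleLaw ν n) (s := Finset.univ)
    (f := fun (i : Fin (n + 1)) (x : Fin (n + 1) → Ω) => φ (x i))
    (fun i _ => hφ.comp_measurePreserving (hev i)) hp
  have h2 : ∀ i : Fin (n + 1), lpNorm (fun x : Fin (n + 1) → Ω => φ (x i)) p (sampleLaw ν n)
      = lpNorm φ p ν := fun i => lpNorm_comp_measurePreserving hφ.1 (hev i)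
  simp only [h2, Finset.sum_const, Finset.card_univ, Fintype.card_fin, nsmul_eq_mul] at h1
  have h3 := lpNorm_const_smul (p := p) ((n : ℝ) + 1)⁻¹
    (∑ i : Fin (n + 1), fun x : Fin (n + 1) → Ω => φ (x i)) (sampleLaw ν n)
  have h4 : ((n : ℝ) + 1)⁻¹ • (∑ i : Fin (n + 1), fun x : Fin (n + 1) → Ω => φ (x i))
      = emp φ n := by
    ext x
    simp [emp]
  have hn : ((‖((n : ℝ) + 1)⁻¹‖₊ : NNReal) : ℝ) = ((n : ℝ) + 1)⁻¹ := by
    rw [coe_nnnorm, Real.norm_eq_abs, abs_of_nonneg (by positivity)]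
  rw [h4, hn] at h3
  rw [h3, pow_zero, mul_one, inv_mul_le_iff₀ (by positivity)]
  simpa using h1

/-- The 2m-th moment of the centred sum grows like n^m, against n^(2m) from the normalisation; this
gains one factor n^{-1/2} in the norm. -/
theorem lpOrder_emp_of_integral_eq_zero {m : ℕ} (hm : m ≠ 0) {φ : Ω → ℝ}
    (hφ : MemLp φ ((2 * m : ℕ)) ν) (h0 : ∫ x, φ x ∂ν = 0) :
    LpOrder (sampleLaw ν) ((2 * m : ℕ)) 1 (emp φ) := by
  obtain ⟨c, hc, h⟩ := exists_integral_sum_pow_le m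
  have hM : 0 ≤ ∫ x, φ x ^ (2 * m) ∂ν :=
    integral_nonneg fun x => (even_two_mul m).pow_nonneg _
  refine LpOrder.of_integral_pow_le hm (memLp_emp hφ) (a := c * ∫ x, φ x ^ (2 * m) ∂ν)
    (by positivity) fun n => ?_
  have h1 := h Ω ν φ hφ h0 (n + 1)
  simp only [emp, mul_pow, integral_const_mul, one_mul]
  rw [pow_mul (scale n), scale_sq, pow_mul, sq, mul_pow]
  have hpos : (0 : ℝ) < ((n : ℝ) + 1) ^ m := by positivity
  calc _ ≤ (((n : ℝ) + 1)⁻¹ ^ m * ((n : ℝ) + 1)⁻¹ ^ m)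
        * (c * ((n + 1 : ℕ) : ℝ) ^ m * ∫ x, φ x ^ (2 * m) ∂ν) := by
        gcongr
        exact h1
    _ = _ := by
      push_cast
      rw [inv_pow]
      field_simp

theorem integral_emp_mul_emp {φ ψ : Ω → ℝ} (hφ : MemLp φ 2 ν) (hψ : MemLp ψ 2 ν)
    (h0 : ∫ x, φ x ∂ν = 0) (n : ℕ) :
    ∫ x, emp φ n x * emp ψ n x ∂(sampleLaw ν n) = ((n : ℝ) + 1)⁻¹ * ∫ x, φ x * ψ x ∂ν := by
  have h := integral_sum_mul_sum hφ hψ h0 (n + 1)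
  have e : ∀ x : Fin (n + 1) → Ω, emp φ n x * emp ψ n x
      = ((n : ℝ) + 1)⁻¹ * ((n : ℝ) + 1)⁻¹ * ((∑ i, φ (x i)) * ∑ i, ψ (x i)) := fun x => by
    unfold emp
    ring
  simp only [e, integral_const_mul]
  unfold sampleLaw
  rw [h]
  push_cast
  field_simp

theorem integral_emp {φ : Ω → ℝ} (hφ : Integrable φ ν) (n : ℕ) :
    ∫ x, emp φ n x ∂(sampleLaw ν n) = ∫ x, φ x ∂ν := by
  unfold emp sampleLaw
  rw [integral_const_mul, integral_sum_coord hφ]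
  push_cast
  field_simp

end Empirical

/-! ### Resampling from a frozen sample -/

section Resampling

/-- The law of the labels of a resample of size `n + 1`. -/
abbrev resampleLaw (n : ℕ) : Measure (Fin (n + 1) → Fin (n + 1)) :=
  sampleLaw (uniformOn (Set.univ : Set (Fin (n + 1)))) n

theorem integral_add_of_finite {α : Type*} [Finite α] [MeasurableSpace α]
    [MeasurableSingletonClass α] {ν : Measure α} [IsFiniteMeasure ν] (f g : α → ℝ) :
    ∫ x, (f x + g x) ∂ν = (∫ x, f x ∂ν) + ∫ x, g x ∂ν :=
  integral_add .of_finite .of_finite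

theorem integral_finsetSum_of_finite {α ι : Type*} [Finite α] [MeasurableSpace α]
    [MeasurableSingletonClass α] {ν : Measure α} [IsFiniteMeasure ν] (s : Finset ι)
    (f : ι → α → ℝ) : ∫ x, ∑ i ∈ s, f i x ∂ν = ∑ i ∈ s, ∫ x, f i x ∂ν :=
  integral_finsetSum _ fun _ _ => .of_finite

/-- The uniform law on labels integrates to the empirical average `emp id`, so formulas for i.i.d.
sums apply to a resample with the sample held fixed. -/
theorem integral_uniformOn_univ (n : ℕ) (w : Fin (n + 1) → ℝ) :
    ∫ i, w i ∂(uniformOn (Set.univ : Set (Fin (n + 1)))) = emp id n w := by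
  rw [integral_fintype .of_finite]
  have h : ∀ i : Fin (n + 1),
      (uniformOn (Set.univ : Set (Fin (n + 1)))).real {i} = ((n : ℝ) + 1)⁻¹ := fun i => by
    rw [Measure.real, uniformOn_univ]
    simp
    norm_cast
  simp only [h, smul_eq_mul, emp, Finset.mul_sum, id]

variable {n : ℕ} {w w' w'' : Fin (n + 1) → ℝ}

theorem integral_resample (hw : emp id n w = 0) :
    ∫ j, emp w n j ∂(resampleLaw n) = 0 := by
  rw [integral_emp .of_finite, integral_uniformOn_univ, hw]

theorem integral_resample_mul (hw : emp id n w = 0) :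
    ∫ j, emp w n j * emp w' n j ∂(resampleLaw n)
      = ((n : ℝ) + 1)⁻¹ * emp id n (fun i => w i * w' i) := by
  rw [integral_emp_mul_emp (MemLp.of_discrete) (MemLp.of_discrete)
    (by rw [integral_uniformOn_univ, hw]), integral_uniformOn_univ]

theorem integral_resample_mul_mul (hw : emp id n w = 0) (hw' : emp id n w' = 0)
    (hw'' : emp id n w'' = 0) :
    ∫ j, emp w n j * (emp w' n j * emp w'' n j) ∂(resampleLaw n)
      = ((n : ℝ) + 1)⁻¹ * (((n : ℝ) + 1)⁻¹ * emp id n (fun i => w i * w' i * w'' i)) := by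
  have h := integral_sum_mul_sum_mul_sum (ν := uniformOn (Set.univ : Set (Fin (n + 1))))
    (f := w) (g := w') (h := w'') (by rw [integral_uniformOn_univ, hw])
    (by rw [integral_uniformOn_univ, hw']) (by rw [integral_uniformOn_univ, hw'']) (n + 1)
  rw [integral_uniformOn_univ] at h
  have e : ∀ j : Fin (n + 1) → Fin (n + 1), emp w n j * (emp w' n j * emp w'' n j)
      = ((n : ℝ) + 1)⁻¹ ^ 3 * ((∑ i, w (j i)) * (∑ i, w' (j i)) * ∑ i, w'' (j i)) := fun j => by
    unfold emp
    ring
  simp only [e, integral_const_mul]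
  unfold resampleLaw sampleLaw
  rw [h]
  push_cast
  field_simp

/-- The constant is uniform in n and in the weights w, so the bound can afterwards be integrated
over the sample that determines w. -/
theorem exists_integral_resample_pow_le (m : ℕ) : ∃ c : ℝ, 0 ≤ c ∧ ∀ (n : ℕ)
    (w : Fin (n + 1) → ℝ), emp id n w = 0 →
    ∫ j, emp w n j ^ (2 * m) ∂(resampleLaw n)
      ≤ c * scale n ^ (2 * m) * emp id n (fun i => w i ^ (2 * m)) := by
  obtain ⟨c, hc, h⟩ := exists_integral_sum_pow_le m
  refine ⟨c, hc, fun n w hw => ?_⟩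
  have h1 := h _ (uniformOn (Set.univ : Set (Fin (n + 1)))) w MemLp.of_discrete
    (by rw [integral_uniformOn_univ, hw]) (n + 1)
  rw [integral_uniformOn_univ] at h1
  simp only [emp, mul_pow, integral_const_mul]
  rw [pow_mul (scale n), scale_sq, pow_mul ((n : ℝ) + 1)⁻¹, sq, mul_pow]
  calc _ ≤ (((n : ℝ) + 1)⁻¹ ^ m * ((n : ℝ) + 1)⁻¹ ^ m)
        * (c * ((n + 1 : ℕ) : ℝ) ^ m * emp id n (fun i => w i ^ (2 * m))) := by
        gcongr
        exact h1
    _ = _ := by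
      unfold emp
      push_cast
      rw [inv_pow]
      field_simp

end Resampling

/-! ### Deviations from the sample mean and their empirical moments -/

section Deviations

variable {d : ℕ} {μ : Measure (EuclideanSpace ℝ (Fin d))}

/-- The centred coordinate `x ↦ (x - x⋆)^a`. -/
def cent (μ : Measure (EuclideanSpace ℝ (Fin d))) (a : Fin d) (x : EuclideanSpace ℝ (Fin d)) : ℝ :=
  x a - mean μ a

/-- The coordinates `(xᵢ - x̄)^a` of the deviations of a sample from its average. -/
def dev (μ : Measure (EuclideanSpace ℝ (Fin d))) (a : Fin d) (n : ℕ)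
    (x : Fin (n + 1) → EuclideanSpace ℝ (Fin d)) (i : Fin (n + 1)) : ℝ :=
  cent μ a (x i) - emp (cent μ a) n x

/-- The joint law of a sample of size `n + 1` and of the labels of one resample. -/
abbrev pairLaw (μ : Measure (EuclideanSpace ℝ (Fin d))) [IsProbabilityMeasure μ] (n : ℕ) :
    Measure ((Fin (n + 1) → EuclideanSpace ℝ (Fin d)) × (Fin (n + 1) → Fin (n + 1))) :=
  (sampleLaw μ n).prod (resampleLaw n)

/-- The coordinates `(x̃ - x̄)^a` of the displacement of the resampled average. -/
def displ (μ : Measure (EuclideanSpace ℝ (Fin d))) (a : Fin d) (n : ℕ)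
    (z : (Fin (n + 1) → EuclideanSpace ℝ (Fin d)) × (Fin (n + 1) → Fin (n + 1))) : ℝ :=
  emp (dev μ a n z.1) n z.2

/-- The empirical covariance. -/
def empCov (μ : Measure (EuclideanSpace ℝ (Fin d))) (a b : Fin d) (n : ℕ)
    (x : Fin (n + 1) → EuclideanSpace ℝ (Fin d)) : ℝ :=
  emp id n fun i => dev μ a n x i * dev μ b n x i

/-- The empirical third central moment. -/
def empThird (μ : Measure (EuclideanSpace ℝ (Fin d))) (a b c : Fin d) (n : ℕ)
    (x : Fin (n + 1) → EuclideanSpace ℝ (Fin d)) : ℝ :=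
  emp id n fun i => dev μ a n x i * dev μ b n x i * dev μ c n x i

theorem emp_const (n : ℕ) (c : ℝ) : emp id n (fun _ => c) = c := by
  simp [emp]
  field_simp

theorem emp_add (n : ℕ) (w w' : Fin (n + 1) → ℝ) :
    emp id n (fun i => w i + w' i) = emp id n w + emp id n w' := by
  simp [emp, Finset.sum_add_distrib, mul_add]

theorem emp_sub (n : ℕ) (w w' : Fin (n + 1) → ℝ) :
    emp id n (fun i => w i - w' i) = emp id n w - emp id n w' := by
  simp [emp, Finset.sum_sub_distrib, mul_sub]

theorem emp_const_mul (n : ℕ) (c : ℝ) (w : Fin (n + 1) → ℝ) :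
    emp id n (fun i => c * w i) = c * emp id n w := by
  simp only [emp, id, ← Finset.mul_sum]
  ring

theorem emp_comp {Ω : Type*} (φ : Ω → ℝ) (n : ℕ) (x : Fin (n + 1) → Ω) :
    emp id n (fun i => φ (x i)) = emp φ n x := rfl

theorem emp_mono (n : ℕ) {w w' : Fin (n + 1) → ℝ} (h : ∀ i, w i ≤ w' i) :
    emp id n w ≤ emp id n w' := by
  unfold emp
  gcongr
  exact h _

theorem emp_dev (a : Fin d) (n : ℕ) (x : Fin (n + 1) → EuclideanSpace ℝ (Fin d)) :
    emp id n (dev μ a n x) = 0 := by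
  have : dev μ a n x = fun i => cent μ a (x i) - (fun _ => emp (cent μ a) n x) i := rfl
  rw [this, emp_sub, emp_const, emp_comp, sub_self]

theorem avg_apply_sub_mean (a : Fin d) (n : ℕ) (x : Fin (n + 1) → EuclideanSpace ℝ (Fin d)) :
    (avg x - mean μ) a = emp (cent μ a) n x := by
  have h : emp (cent μ a) n x = emp id n (fun i => x i a - (fun _ => mean μ a) i) := rfl
  rw [h, emp_sub, emp_const]
  simp [avg, emp]

theorem avg_resample_apply_sub_mean (a : Fin d) (n : ℕ)
    (z : (Fin (n + 1) → EuclideanSpace ℝ (Fin d)) × (Fin (n + 1) → Fin (n + 1))) :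
    (avg (fun i => z.1 (z.2 i)) - mean μ) a = emp (cent μ a) n z.1 + displ μ a n z := by
  have h : displ μ a n z = emp id n (fun i => cent μ a (z.1 (z.2 i))
    - (fun _ => emp (cent μ a) n z.1) i) := rfl
  rw [avg_apply_sub_mean, h, emp_sub, emp_const, ← emp_comp]
  ring

theorem empCov_eq (a b : Fin d) (n : ℕ) (x : Fin (n + 1) → EuclideanSpace ℝ (Fin d)) :
    empCov μ a b n x = emp (fun x => cent μ a x * cent μ b x) n x
      - emp (cent μ a) n x * emp (cent μ b) n x := by
  have h : empCov μ a b n x = emp id n (fun i => (cent μ a (x i) * cent μ b (x i)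
      - emp (cent μ a) n x * cent μ b (x i)) - emp (cent μ b) n x * dev μ a n x i) := by
    unfold empCov
    congr 1
    ext i
    unfold dev
    ring
  rw [h, emp_sub, emp_sub, emp_const_mul, emp_const_mul, emp_dev, emp_comp (cent μ b),
    emp_comp (fun x => cent μ a x * cent μ b x)]
  ring

theorem empThird_eq (a b c : Fin d) (n : ℕ) (x : Fin (n + 1) → EuclideanSpace ℝ (Fin d)) :
    empThird μ a b c n x = emp (fun x => cent μ a x * cent μ b x * cent μ c x) n x
      - emp (cent μ c) n x * emp (fun x => cent μ a x * cent μ b x) n x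
      - emp (cent μ a) n x * empCov μ b c n x - emp (cent μ b) n x * empCov μ a c n x := by
  have h : empThird μ a b c n x = emp id n (fun i => (((cent μ a (x i) * cent μ b (x i)
      * cent μ c (x i) - emp (cent μ c) n x * (cent μ a (x i) * cent μ b (x i)))
      - emp (cent μ a) n x * (dev μ b n x i * dev μ c n x i))
      - emp (cent μ b) n x * (dev μ a n x i * dev μ c n x i))
      - emp (cent μ a) n x * emp (cent μ b) n x * dev μ c n x i) := by
    unfold empThird
    congr 1
    ext i
    unfold dev
    ring
  rw [h, emp_sub, emp_sub, emp_sub, emp_sub, emp_const_mul, emp_const_mul, emp_const_mul,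
    emp_const_mul, emp_dev, emp_comp (fun x => cent μ a x * cent μ b x),
    emp_comp (fun x => cent μ a x * cent μ b x * cent μ c x)]
  unfold empCov
  ring

/-- Isolates an average of i.i.d. centred variables, of order 1; the correction for using x̄ in
place of x⋆ has order 2. -/
theorem empCov_sub_eq (a b : Fin d) (n : ℕ) (x : Fin (n + 1) → EuclideanSpace ℝ (Fin d)) :
    empCov μ a b n x - M2 μ a b = emp (fun x => cent μ a x * cent μ b x - M2 μ a b) n x
      - emp (cent μ a) n x * emp (cent μ b) n x := by
  rw [empCov_eq, ← emp_comp (fun x => cent μ a x * cent μ b x - M2 μ a b), emp_sub, emp_const,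
    emp_comp (fun x => cent μ a x * cent μ b x)]
  ring

theorem measurable_cent (a : Fin d) : Measurable (cent μ a) := by
  unfold cent
  fun_prop

theorem measurable_displ (a : Fin d) (n : ℕ) : Measurable (displ μ a n) := by
  refine measurable_from_prod_countable_left fun j => ?_
  have := measurable_cent (μ := μ) a
  unfold displ dev emp
  fun_prop

variable [IsProbabilityMeasure μ]

theorem memLp_cent (hμ : MemLp (fun x : EuclideanSpace ℝ (Fin d) => x) 8 μ)
    (a : Fin d) : MemLp (cent μ a) 8 μ :=
  ((EuclideanSpace.proj a : EuclideanSpace ℝ (Fin d) →L[ℝ] ℝ).comp_memLp' hμ).sub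
    (memLp_const (mean μ a))

theorem integral_cent (hμ : MemLp (fun x : EuclideanSpace ℝ (Fin d) => x) 8 μ)
    (a : Fin d) : ∫ x, cent μ a x ∂μ = 0 := by
  have hi : Integrable (fun x : EuclideanSpace ℝ (Fin d) => x) μ := hμ.integrable (by norm_num)
  have h := (EuclideanSpace.proj a : EuclideanSpace ℝ (Fin d) →L[ℝ] ℝ).integral_comp_comm hi
  have hi' := (EuclideanSpace.proj a : EuclideanSpace ℝ (Fin d) →L[ℝ] ℝ).integrable_comp hi
  change ∫ x : EuclideanSpace ℝ (Fin d), x a ∂μ = mean μ a at h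
  change Integrable (fun x : EuclideanSpace ℝ (Fin d) => x a) μ at hi'
  unfold cent
  rw [integral_sub hi' (integrable_const _), h]
  simp

theorem memLp_cent_mul (hμ : MemLp (fun x : EuclideanSpace ℝ (Fin d) => x) 8 μ)
    (a b : Fin d) : MemLp (fun x => cent μ a x * cent μ b x) 4 μ :=
  have := holderTriple_eight
  (memLp_cent hμ b).mul (memLp_cent hμ a)

theorem memLp_cent_mul_mul (hμ : MemLp (fun x : EuclideanSpace ℝ (Fin d) => x) 8 μ)
    (a b c : Fin d) :
    MemLp (fun x => cent μ a x * cent μ b x * cent μ c x) 2 μ :=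
  have := holderTriple_four
  ((memLp_cent hμ c).mono_exponent (p := 4) (by norm_num)).mul (memLp_cent_mul hμ a b)

theorem lpOrder_emp_cent (hμ : MemLp (fun x : EuclideanSpace ℝ (Fin d) => x) 8 μ)
    (a : Fin d) : LpOrder (sampleLaw μ) 8 1 (emp (cent μ a)) :=
  lpOrder_emp_of_integral_eq_zero (m := 4) (by norm_num) (memLp_cent hμ a) (integral_cent hμ a)

theorem lpOrder_emp_cent_mul (hμ : MemLp (fun x : EuclideanSpace ℝ (Fin d) => x) 8 μ)
    (a b : Fin d) :
    LpOrder (sampleLaw μ) 4 2 (fun n x => emp (cent μ a) n x * emp (cent μ b) n x) :=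
  have := holderTriple_eight
  (lpOrder_emp_cent hμ a).mul (lpOrder_emp_cent hμ b)

theorem memLp_cent_mul_sub (hμ : MemLp (fun x : EuclideanSpace ℝ (Fin d) => x) 8 μ)
    (a b : Fin d) :
    MemLp (fun x => cent μ a x * cent μ b x - M2 μ a b) 4 μ :=
  (memLp_cent_mul hμ a b).sub (memLp_const _)

theorem integral_cent_mul_sub (hμ : MemLp (fun x : EuclideanSpace ℝ (Fin d) => x) 8 μ)
    (a b : Fin d) :
    ∫ x, (cent μ a x * cent μ b x - M2 μ a b) ∂μ = 0 := by
  rw [integral_sub ((memLp_cent_mul hμ a b).integrable (by norm_num)) (integrable_const _)]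
  simp [M2, cent]

theorem lpOrder_emp_cent_mul_sub (hμ : MemLp (fun x : EuclideanSpace ℝ (Fin d) => x) 8 μ)
    (a b : Fin d) :
    LpOrder (sampleLaw μ) 4 1 (emp fun x => cent μ a x * cent μ b x - M2 μ a b) :=
  lpOrder_emp_of_integral_eq_zero (m := 2) (by norm_num) (memLp_cent_mul_sub hμ a b)
    (integral_cent_mul_sub hμ a b)

theorem lpOrder_empCov_sub (hμ : MemLp (fun x : EuclideanSpace ℝ (Fin d) => x) 8 μ)
    (a b : Fin d) :
    LpOrder (sampleLaw μ) 4 1 (fun n x => empCov μ a b n x - M2 μ a b) := by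
  simp only [empCov_sub_eq]
  exact (lpOrder_emp_cent_mul_sub hμ a b).sub (by norm_num)
    ((lpOrder_emp_cent_mul hμ a b).mono_order (by norm_num))

theorem lpOrder_empCov (hμ : MemLp (fun x : EuclideanSpace ℝ (Fin d) => x) 8 μ)
    (a b : Fin d) : LpOrder (sampleLaw μ) 4 0 (empCov μ a b) := by
  have h := ((lpOrder_empCov_sub hμ a b).mono_order (Nat.zero_le 1)).add (by norm_num)
    (LpOrder.const (P := sampleLaw μ) (p := 4) (by norm_num) (M2 μ a b))
  simpa using h

theorem lpOrder_empThird (hμ : MemLp (fun x : EuclideanSpace ℝ (Fin d) => x) 8 μ)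
    (a b c : Fin d) : LpOrder (sampleLaw μ) 2 0 (empThird μ a b c) := by
  have := holderTriple_four
  have hu : ∀ a, LpOrder (sampleLaw μ) 4 0 (emp (cent μ a)) := fun a =>
    ((lpOrder_emp_cent hμ a).mono_order (Nat.zero_le 1)).mono_exponent (by norm_num)
  have h := (((lpOrder_emp (by norm_num) (memLp_cent_mul_mul hμ a b c)).sub (by norm_num)
    ((hu c).mul (lpOrder_emp (by norm_num) (memLp_cent_mul hμ a b)))).sub (by norm_num)
    ((hu a).mul (lpOrder_empCov hμ b c))).sub (by norm_num)
    ((hu b).mul (lpOrder_empCov hμ a c))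
  simpa only [← empThird_eq] using h

/-- Given the sample, the displacement is an average of i.i.d. labels weighted by deviations of
empirical mean zero, so its eighth moment is at most c n⁻⁴ times their empirical eighth moment. The
latter has bounded expectation. -/
theorem lpOrder_displ (hμ : MemLp (fun x : EuclideanSpace ℝ (Fin d) => x) 8 μ)
    (a : Fin d) : LpOrder (pairLaw μ) 8 1 (displ μ a) := by
  obtain ⟨c, hc, h⟩ := exists_integral_resample_pow_le 4
  obtain ⟨A, hA, hu⟩ := LpOrder.integral_pow_le (m := 4) (by norm_num)
    (show LpOrder (sampleLaw μ) ((2 * 4 : ℕ)) 0 (emp (cent μ a)) from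
      (lpOrder_emp_cent hμ a).mono_order (Nat.zero_le 1))
  have hu8 : ∀ n, Integrable (fun x => emp (cent μ a) n x ^ 8) (sampleLaw μ n) := fun n =>
    integrable_pow_of_memLp (p := 8) ((lpOrder_emp_cent hμ a).memLp n) le_rfl
  have hc8 : Integrable (fun x => cent μ a x ^ 8) μ :=
    integrable_pow_of_memLp (p := 8) (memLp_cent hμ a) le_rfl
  have he8 : ∀ n, Integrable (emp (fun x => cent μ a x ^ 8) n) (sampleLaw μ n) := fun n =>
    (memLp_emp (memLp_one_iff_integrable.2 hc8) n).integrable le_rfl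
  set D : ∀ n, (Fin (n + 1) → EuclideanSpace ℝ (Fin d)) → ℝ := fun n x =>
    c * scale n ^ 8 * (2 ^ 7 * (emp (fun x => cent μ a x ^ 8) n x + emp (cent μ a) n x ^ 8)) with hD
  have hDi : ∀ n, Integrable (D n) (sampleLaw μ n) := fun n =>
    (((he8 n).add (hu8 n)).const_mul _).const_mul _
  have hin : ∀ n x, ∫ j, displ μ a n (x, j) ^ 8 ∂(resampleLaw n) ≤ D n x := by
    intro n x
    refine (h n (dev μ a n x) (emp_dev a n x)).trans ?_
    refine mul_le_mul_of_nonneg_left ?_ (mul_nonneg hc (pow_nonneg (scale_pos n).le _))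
    have hle : ∀ i, dev μ a n x i ^ (2 * 4)
        ≤ 2 ^ 7 * (cent μ a (x i) ^ 8 + (fun _ => emp (cent μ a) n x ^ 8) i) := by
      intro i
      -- Convexity: (s + t)⁸ ≤ 2⁷(s⁸ + t⁸).
      have := Even.add_pow_le (n := 8) (by decide) (a := cent μ a (x i)) (b := -emp (cent μ a) n x)
      rw [Even.neg_pow (by decide)] at this
      exact this
    refine (emp_mono n hle).trans (le_of_eq ?_)
    rw [emp_const_mul, emp_add, emp_const, emp_comp (fun x => cent μ a x ^ 8)]
  have hm : ∀ n, AEStronglyMeasurable (displ μ a n) (pairLaw μ n) := fun n =>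
    (measurable_displ a n).aestronglyMeasurable
  have hi : ∀ n, Integrable (fun z => displ μ a n z ^ 8) (pairLaw μ n) := by
    intro n
    refine (integrable_prod_iff ((hm n).pow 8)).2
      ⟨Filter.Eventually.of_forall fun x => .of_finite, ?_⟩
    refine (hDi n).mono' ((hm n).pow 8).norm.integral_prod_right' ?_
    refine Filter.Eventually.of_forall fun x => ?_
    have e : ∀ j, ‖displ μ a n (x, j) ^ 8‖ = displ μ a n (x, j) ^ 8 := fun j =>
      Real.norm_of_nonneg (Even.pow_nonneg (by decide) _)
    simp only [Pi.pow_apply, e]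
    rw [Real.norm_of_nonneg (integral_nonneg fun j => Even.pow_nonneg (by decide) _)]
    exact hin n x
  have hmem : ∀ n, MemLp (displ μ a n) 8 (pairLaw μ n) := by
    intro n
    have := (integrable_norm_rpow_iff (p := 8) (hm n) (by norm_num) (by simp)).1
    refine this ?_
    convert! hi n using 2 with z
    have h8 : (8 : ENNReal).toReal = ((8 : ℕ) : ℝ) := by norm_num
    rw [h8, Real.rpow_natCast, Real.norm_eq_abs, Even.pow_abs (by decide)]
  refine LpOrder.of_integral_pow_le (m := 4) (by norm_num) hmem
    (a := c * (2 ^ 7 * (∫ x, cent μ a x ^ 8 ∂μ + A))) ?_ fun n => ?_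
  · have : 0 ≤ ∫ x, cent μ a x ^ 8 ∂μ := integral_nonneg fun x => Even.pow_nonneg (by decide) _
    positivity
  · have h1 : ∫ z, displ μ a n z ^ 8 ∂(pairLaw μ n) ≤ ∫ x, D n x ∂(sampleLaw μ n) := by
      rw [integral_prod _ (hi n)]
      exact integral_mono (hi n).integral_prod_left (hDi n) (hin n)
    refine h1.trans ?_
    simp only [hD, integral_const_mul]
    rw [integral_add (he8 n) (hu8 n), integral_emp hc8]
    have h2 := hu n
    simp only [zero_mul, pow_zero, mul_one] at h2
    have h3 : 0 ≤ c * scale n ^ 8 * 2 ^ 7 := by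
      have := scale_pos n
      positivity
    calc _ = c * scale n ^ 8 * 2 ^ 7 * (∫ x, cent μ a x ^ 8 ∂μ
          + ∫ x, emp (cent μ a) n x ^ 8 ∂(sampleLaw μ n)) := by ring
      _ ≤ c * scale n ^ 8 * 2 ^ 7 * (∫ x, cent μ a x ^ 8 ∂μ + A) := by
        gcongr
      _ = _ := by ring

end Deviations

/-! ### Polynomial algebra of cubic expansions -/

section Forms

variable {d : ℕ}

/-- The linear form with coefficients `p`. -/
def lin (p : Fin d → ℝ) (h : Fin d → ℝ) : ℝ := ∑ a, p a * h a

/-- The quadratic form with coefficients `H`. -/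
def quad (H : Fin d → Fin d → ℝ) (h : Fin d → ℝ) : ℝ := ∑ a, ∑ b, H a b * (h a * h b)

/-- The cubic form with coefficients `T`. -/
def cub (T : Fin d → Fin d → Fin d → ℝ) (h : Fin d → ℝ) : ℝ :=
  ∑ a, ∑ b, ∑ c, T a b c * (h a * h b * h c)

/-- The inhomogeneous cubic polynomial with coefficients `p`, `H / 2`, `T / 6`. -/
def cubicPoly (p : Fin d → ℝ) (H : Fin d → Fin d → ℝ) (T : Fin d → Fin d → Fin d → ℝ)
    (h : Fin d → ℝ) : ℝ := lin p h + 2⁻¹ * quad H h + 6⁻¹ * cub T h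

/-- Each term is a function of u times a monomial in v. With v the resampling displacement and u
frozen, conditional expectation acts monomial by monomial. -/
theorem cubicPoly_add_sub (p : Fin d → ℝ) (H : Fin d → Fin d → ℝ)
    (T : Fin d → Fin d → Fin d → ℝ) (u v : Fin d → ℝ) :
    cubicPoly p H T (fun a => u a + v a) - cubicPoly p H T u = lin p v
      + 2⁻¹ * ∑ a, ∑ b, H a b * (u a * v b + u b * v a + v a * v b)
      + 6⁻¹ * ∑ a, ∑ b, ∑ c, T a b c * (u a * u b * v c + u a * u c * v b + u b * u c * v a
        + u a * (v b * v c) + u b * (v a * v c) + u c * (v a * v b) + v a * (v b * v c)) := by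
  have h1 : lin p (fun a => u a + v a) - lin p u = lin p v := by
    simp [lin, mul_add, Finset.sum_add_distrib]
  have h2 : quad H (fun a => u a + v a) - quad H u
      = ∑ a, ∑ b, H a b * (u a * v b + u b * v a + v a * v b) := by
    simp only [quad, ← Finset.sum_sub_distrib]
    refine Finset.sum_congr rfl fun a _ => Finset.sum_congr rfl fun b _ => ?_
    ring
  have h3 : cub T (fun a => u a + v a) - cub T u
      = ∑ a, ∑ b, ∑ c, T a b c * (u a * u b * v c + u a * u c * v b + u b * u c * v a
        + u a * (v b * v c) + u b * (v a * v c) + u c * (v a * v b) + v a * (v b * v c)) := by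
    simp only [cub, ← Finset.sum_sub_distrib]
    refine Finset.sum_congr rfl fun a _ => Finset.sum_congr rfl fun b _ =>
      Finset.sum_congr rfl fun c _ => ?_
    ring
  unfold cubicPoly
  rw [← h1, ← h2, ← h3]
  ring

/-- By symmetry of T the three placements of u contribute equally; the factor 3 turns the Taylor
coefficient 1/6 into 1/2. -/
theorem sum_symm_contract {T : Fin d → Fin d → Fin d → ℝ} (hT : ∀ a b c, T a b c = T b a c)
    (hT' : ∀ a b c, T a b c = T a c b) (u : Fin d → ℝ) (C : Fin d → Fin d → ℝ) :
    ∑ a, ∑ b, ∑ c, T a b c * (u a * C b c + u b * C a c + u c * C a b)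
      = 3 * ∑ a, ∑ b, ∑ c, T a b c * (u a * C b c) := by
  have h1 : ∑ a, ∑ b, ∑ c, T a b c * (u b * C a c) = ∑ a, ∑ b, ∑ c, T a b c * (u a * C b c) := by
    rw [Finset.sum_comm]
    refine Finset.sum_congr rfl fun a _ => Finset.sum_congr rfl fun b _ =>
      Finset.sum_congr rfl fun c _ => ?_
    rw [hT]
  have h2 : ∑ a, ∑ b, ∑ c, T a b c * (u c * C a b) = ∑ a, ∑ b, ∑ c, T a b c * (u a * C b c) := by
    rw [Finset.sum_comm' (t' := Finset.univ) (s' := fun _ => Finset.univ) (by simp), ← h1]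
    rw [Finset.sum_comm]
    refine Finset.sum_congr rfl fun a _ => ?_
    rw [Finset.sum_comm]
    refine Finset.sum_congr rfl fun b _ => Finset.sum_congr rfl fun c _ => ?_
    rw [hT']
  simp only [mul_add, Finset.sum_add_distrib, h1, h2]
  ring

end Forms

/-! ### Orders of forms and of quartic remainders -/

section Remainder

variable {d : ℕ} {Ω : ℕ → Type*} [∀ n, MeasurableSpace (Ω n)] {P : ∀ n, Measure (Ω n)}

theorem norm_le_sum_abs (h : EuclideanSpace ℝ (Fin d)) : ‖h‖ ≤ ∑ a, |h a| := by
  rw [EuclideanSpace.norm_eq]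
  refine Real.sqrt_le_iff.2 ⟨Finset.sum_nonneg fun a _ => abs_nonneg _, ?_⟩
  simp only [Real.norm_eq_abs]
  exact Finset.sum_sq_le_sq_sum_of_nonneg fun a _ => abs_nonneg _

/-- Bound ‖X‖ by the ℓ¹ norm and apply Hölder twice, L⁸ → L⁴ → L². This is where the eighth moment
is spent. -/
theorem lpOrder_of_le_norm_pow_four {R : EuclideanSpace ℝ (Fin d) → ℝ} (hR : Continuous R) {B : ℝ}
    (hB : ∀ h, |R h| ≤ B * ‖h‖ ^ 4) {X : ∀ n, Ω n → EuclideanSpace ℝ (Fin d)}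
    (hX : ∀ n, Measurable (X n)) (hX8 : ∀ a, LpOrder P 8 1 fun n x => X n x a) :
    LpOrder P 2 4 fun n x => R (X n x) := by
  have := holderTriple_eight
  have := holderTriple_four
  have hs : LpOrder P 8 1 fun n x => ∑ a, |X n x a| :=
    LpOrder.sum _ (by norm_num) fun a _ => (hX8 a).abs
  have h2 := hs.mul (r := 4) hs
  have h4 := (h2.mul (r := 2) h2).const_mul |B|
  refine h4.of_abs_le (fun n => (hR.measurable.comp (hX n)).aestronglyMeasurable) fun n x => ?_
  refine (hB _).trans ?_
  have h0 := norm_nonneg (X n x)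
  calc B * ‖X n x‖ ^ 4 ≤ |B| * (∑ a, |X n x a|) ^ 4 := by
        gcongr
        · exact le_abs_self B
        · exact norm_le_sum_abs _
    _ = _ := by ring

theorem lpOrder_lin {p : Fin d → ℝ} {q : ENNReal} (hq : 1 ≤ q) {k : ℕ}
    {X : Fin d → ∀ n, Ω n → ℝ} (hX : ∀ a, LpOrder P q k (X a)) :
    LpOrder P q k fun n x => lin p fun a => X a n x :=
  LpOrder.sum _ hq fun a _ => (hX a).const_mul (p a)

theorem lpOrder_quad {H : Fin d → Fin d → ℝ} {X : Fin d → ∀ n, Ω n → ℝ}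
    (hX : ∀ a, LpOrder P 8 1 (X a)) : LpOrder P 4 2 fun n x => quad H fun a => X a n x :=
  have := holderTriple_eight
  LpOrder.sum _ (by norm_num) fun a _ => LpOrder.sum _ (by norm_num) fun b _ =>
    ((hX a).mul (hX b)).const_mul (H a b)

theorem lpOrder_cub [∀ n, IsProbabilityMeasure (P n)] {T : Fin d → Fin d → Fin d → ℝ}
    {X : Fin d → ∀ n, Ω n → ℝ} (hX : ∀ a, LpOrder P 8 1 (X a)) :
    LpOrder P 2 3 fun n x => cub T fun a => X a n x :=
  have := holderTriple_eight
  have := holderTriple_four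
  LpOrder.sum _ (by norm_num) fun a _ => LpOrder.sum _ (by norm_num) fun b _ =>
    LpOrder.sum _ (by norm_num) fun c _ =>
    (((hX a).mul (r := 4) (hX b)).mul ((hX c).mono_exponent (p := 4) (by norm_num))).const_mul (T a b c)

end Remainder

/-! ### Conditional mean of the polynomial increment -/

section Resampled

variable {d : ℕ} {μ : Measure (EuclideanSpace ℝ (Fin d))}

/-- Given the sample the displacement has mean zero, covariance `empCov` divided by n + 1, and third
moments `empThird` divided by (n + 1)². Terms linear in it vanish. -/
theorem integral_cubicPoly_displ {p : Fin d → ℝ} {H : Fin d → Fin d → ℝ}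
    {T : Fin d → Fin d → Fin d → ℝ} (hT : ∀ a b c, T a b c = T b a c)
    (hT' : ∀ a b c, T a b c = T a c b) (n : ℕ) (x : Fin (n + 1) → EuclideanSpace ℝ (Fin d)) :
    ∫ j, (cubicPoly p H T (fun a => emp (cent μ a) n x + displ μ a n (x, j))
        - cubicPoly p H T fun a => emp (cent μ a) n x) ∂(resampleLaw n)
      = ((n : ℝ) + 1)⁻¹ * (2⁻¹ * (∑ a, ∑ b, H a b * empCov μ a b n x
          + ∑ a, ∑ b, ∑ c, T a b c * (emp (cent μ a) n x * empCov μ b c n x))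
        + ((n : ℝ) + 1)⁻¹ * (6⁻¹ * ∑ a, ∑ b, ∑ c, T a b c * empThird μ a b c n x)) := by
  have e1 : ∀ a, ∫ j, displ μ a n (x, j) ∂(resampleLaw n) = 0 := fun a =>
    integral_resample (emp_dev a n x)
  have e2 : ∀ a b, ∫ j, displ μ a n (x, j) * displ μ b n (x, j) ∂(resampleLaw n)
      = ((n : ℝ) + 1)⁻¹ * empCov μ a b n x := fun a b =>
    integral_resample_mul (w' := dev μ b n x) (emp_dev a n x)
  have e3 : ∀ a b c, ∫ j, displ μ a n (x, j) * (displ μ b n (x, j) * displ μ c n (x, j))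
      ∂(resampleLaw n) = ((n : ℝ) + 1)⁻¹ * (((n : ℝ) + 1)⁻¹ * empThird μ a b c n x) :=
    fun a b c => integral_resample_mul_mul (emp_dev a n x) (emp_dev b n x) (emp_dev c n x)
  simp only [cubicPoly_add_sub, lin, integral_add_of_finite, integral_finsetSum_of_finite,
    integral_const_mul, e1, e2, e3, mul_zero, zero_add, Finset.sum_const_zero]
  have h1 : ∀ a b c, T a b c * (emp (cent μ a) n x * (((n : ℝ) + 1)⁻¹ * empCov μ b c n x)
      + emp (cent μ b) n x * (((n : ℝ) + 1)⁻¹ * empCov μ a c n x)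
      + emp (cent μ c) n x * (((n : ℝ) + 1)⁻¹ * empCov μ a b n x)
      + ((n : ℝ) + 1)⁻¹ * (((n : ℝ) + 1)⁻¹ * empThird μ a b c n x))
      = ((n : ℝ) + 1)⁻¹ * (T a b c * (emp (cent μ a) n x * empCov μ b c n x
      + emp (cent μ b) n x * empCov μ a c n x + emp (cent μ c) n x * empCov μ a b n x))
      + ((n : ℝ) + 1)⁻¹ * (((n : ℝ) + 1)⁻¹ * (T a b c * empThird μ a b c n x)) := fun a b c => by
    ring
  have h2 : ∀ a b, H a b * (((n : ℝ) + 1)⁻¹ * empCov μ a b n x)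
      = ((n : ℝ) + 1)⁻¹ * (H a b * empCov μ a b n x) := fun a b => by ring
  simp only [h1, h2, Finset.sum_add_distrib, ← Finset.mul_sum]
  rw [sum_symm_contract hT hT' (fun a => emp (cent μ a) n x) (fun a b => empCov μ a b n x)]
  ring

end Resampled

/-! ### Expansions of the error, the increment and its bootstrap mean -/

section Expansion

variable {d : ℕ} {μ : Measure (EuclideanSpace ℝ (Fin d))}

/-- The error `F(x̄) - F(x⋆)`. -/
def err (μ : Measure (EuclideanSpace ℝ (Fin d))) (F : EuclideanSpace ℝ (Fin d) → ℝ) (n : ℕ)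
    (x : Fin (n + 1) → EuclideanSpace ℝ (Fin d)) : ℝ :=
  F (avg x) - F (mean μ)

/-- The increment `F(x̃) - F(x̄)` of one resample. -/
def jump (F : EuclideanSpace ℝ (Fin d) → ℝ) (n : ℕ)
    (z : (Fin (n + 1) → EuclideanSpace ℝ (Fin d)) × (Fin (n + 1) → Fin (n + 1))) : ℝ :=
  F (avg fun i => z.1 (z.2 i)) - F (avg z.1)

/-- The bootstrap mean of the increment `F(x̃) - F(x̄)`. -/
def meanJump (F : EuclideanSpace ℝ (Fin d) → ℝ) (n : ℕ)
    (x : Fin (n + 1) → EuclideanSpace ℝ (Fin d)) : ℝ :=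
  ∫ j, jump F n (x, j) ∂(resampleLaw n)

/-- `F` agrees with a cubic polynomial at `x⋆` up to a quartic remainder. -/
structure CubicExpansion (μ : Measure (EuclideanSpace ℝ (Fin d)))
    (F : EuclideanSpace ℝ (Fin d) → ℝ) (p : Fin d → ℝ) (H : Fin d → Fin d → ℝ)
    (T : Fin d → Fin d → Fin d → ℝ) : Prop where
  continuous : Continuous F
  bound : ∃ B : ℝ, ∀ h : EuclideanSpace ℝ (Fin d),
    |F (mean μ + h) - F (mean μ) - cubicPoly p H T h| ≤ B * ‖h‖ ^ 4

theorem measurable_avg (n : ℕ) :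
    Measurable (avg : (Fin n → EuclideanSpace ℝ (Fin d)) → EuclideanSpace ℝ (Fin d)) := by
  unfold avg
  fun_prop

theorem measurable_avg_resample (n : ℕ) : Measurable
    fun z : (Fin n → EuclideanSpace ℝ (Fin d)) × (Fin n → Fin n) => avg fun i => z.1 (z.2 i) :=
  measurable_from_prod_countable_left fun _ =>
    (measurable_avg n).comp (measurable_pi_lambda _ fun _ => measurable_pi_apply _)

theorem continuous_cubicPoly (p : Fin d → ℝ) (H : Fin d → Fin d → ℝ)
    (T : Fin d → Fin d → Fin d → ℝ) :
    Continuous fun h : EuclideanSpace ℝ (Fin d) => cubicPoly p H T h := by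
  unfold cubicPoly lin quad cub
  fun_prop

variable [IsProbabilityMeasure μ] {F : EuclideanSpace ℝ (Fin d) → ℝ} {p : Fin d → ℝ}
  {H : Fin d → Fin d → ℝ} {T : Fin d → Fin d → Fin d → ℝ}

theorem lpOrder_emp_cent_fst (hμ : MemLp (fun x : EuclideanSpace ℝ (Fin d) => x) 8 μ) (a : Fin d) :
    LpOrder (pairLaw μ) 8 1 fun n z => emp (cent μ a) n z.1 :=
  (lpOrder_emp_cent hμ a).comp fun _ => measurePreserving_fst

theorem lpOrder_remainder_avg (hμ : MemLp (fun x : EuclideanSpace ℝ (Fin d) => x) 8 μ)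
    (hF : CubicExpansion μ F p H T) :
    LpOrder (sampleLaw μ) 2 4 fun n x =>
      err μ F n x - cubicPoly p H T fun a => emp (cent μ a) n x := by
  obtain ⟨B, hB⟩ := hF.bound
  have hc := hF.continuous
  have hc' := continuous_cubicPoly p H T
  have h := lpOrder_of_le_norm_pow_four (P := sampleLaw μ)
    (R := fun h => F (mean μ + h) - F (mean μ) - cubicPoly p H T h) (by fun_prop) hB
    (X := fun n x => avg x - mean μ) (fun n => (measurable_avg _).sub_const _)
    (fun a => by simpa only [avg_apply_sub_mean] using lpOrder_emp_cent hμ a)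
  have e : ∀ n (x : Fin (n + 1) → EuclideanSpace ℝ (Fin d)),
      (fun a => emp (cent μ a) n x) = ⇑(avg x - mean μ) := fun n x =>
    funext fun a => (avg_apply_sub_mean a n x).symm
  simpa only [add_sub_cancel, e, err] using h

theorem lpOrder_remainder_avg_resample
    (hμ : MemLp (fun x : EuclideanSpace ℝ (Fin d) => x) 8 μ) (hF : CubicExpansion μ F p H T) :
    LpOrder (pairLaw μ) 2 4 fun n z => F (avg fun i => z.1 (z.2 i)) - F (mean μ)
      - cubicPoly p H T fun a => emp (cent μ a) n z.1 + displ μ a n z := by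
  obtain ⟨B, hB⟩ := hF.bound
  have hc := hF.continuous
  have hc' := continuous_cubicPoly p H T
  have h := lpOrder_of_le_norm_pow_four (P := pairLaw μ)
    (R := fun h => F (mean μ + h) - F (mean μ) - cubicPoly p H T h) (by fun_prop) hB
    (X := fun n z => avg (fun i => z.1 (z.2 i)) - mean μ)
    (fun n => (measurable_avg_resample _).sub_const _)
    (fun a => by
      simpa only [avg_resample_apply_sub_mean] using
        (lpOrder_emp_cent_fst hμ a).add (by norm_num) (lpOrder_displ hμ a))
  have e : ∀ n (z : (Fin (n + 1) → EuclideanSpace ℝ (Fin d)) × (Fin (n + 1) → Fin (n + 1))),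
      (fun a => emp (cent μ a) n z.1 + displ μ a n z)
        = ⇑(avg (fun i => z.1 (z.2 i)) - mean μ) := fun n z =>
    funext fun a => (avg_resample_apply_sub_mean a n z).symm
  simpa only [add_sub_cancel, e] using h

theorem lpOrder_err_sub (hμ : MemLp (fun x : EuclideanSpace ℝ (Fin d) => x) 8 μ)
    (hF : CubicExpansion μ F p H T) :
    LpOrder (sampleLaw μ) 2 3 fun n x => err μ F n x - (lin p (fun a => emp (cent μ a) n x)
      + 2⁻¹ * quad H fun a => emp (cent μ a) n x) := by
  have h := ((lpOrder_remainder_avg hμ hF).mono_order (by norm_num)).add (by norm_num)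
    ((lpOrder_cub (T := T) (lpOrder_emp_cent hμ)).const_mul 6⁻¹)
  convert! h using 3
  unfold cubicPoly
  ring

theorem lpOrder_err (hμ : MemLp (fun x : EuclideanSpace ℝ (Fin d) => x) 8 μ)
    (hF : CubicExpansion μ F p H T) : LpOrder (sampleLaw μ) 2 1 (err μ F) := by
  have h1 := (lpOrder_lin (p := p) (by norm_num) (lpOrder_emp_cent hμ)).mono_exponent
    (p := 2) (by norm_num)
  have h2 := (((lpOrder_quad (H := H) (lpOrder_emp_cent hμ)).const_mul 2⁻¹).mono_exponent
    (p := 2) (by norm_num)).mono_order (k := 1) (by norm_num)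
  have h := ((lpOrder_err_sub hμ hF).mono_order (k := 1) (by norm_num)).add (by norm_num)
    (h1.add (by norm_num) h2)
  simpa using h

theorem lpOrder_jump_sub_cubicPoly (hμ : MemLp (fun x : EuclideanSpace ℝ (Fin d) => x) 8 μ)
    (hF : CubicExpansion μ F p H T) :
    LpOrder (pairLaw μ) 2 4 fun n z => jump F n z
      - (cubicPoly p H T (fun a => emp (cent μ a) n z.1 + displ μ a n z)
        - cubicPoly p H T fun a => emp (cent μ a) n z.1) := by
  have h := (lpOrder_remainder_avg_resample hμ hF).sub (by norm_num)
    ((lpOrder_remainder_avg hμ hF).comp (P' := pairLaw μ) fun _ => measurePreserving_fst)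
  convert! h using 3
  unfold jump err
  ring

theorem lpOrder_jump_sub_lin (hμ : MemLp (fun x : EuclideanSpace ℝ (Fin d) => x) 8 μ)
    (hF : CubicExpansion μ F p H T) :
    LpOrder (pairLaw μ) 2 2 fun n z => jump F n z - lin p fun a => displ μ a n z := by
  have hu := fun a => lpOrder_emp_cent_fst hμ a
  have huv := fun a => (hu a).add (by norm_num) (lpOrder_displ hμ a)
  have hq := (((lpOrder_quad (H := H) huv).sub (by norm_num) (lpOrder_quad (H := H) hu)).const_mul
    2⁻¹).mono_exponent (p := 2) (by norm_num)
  have hc := (((lpOrder_cub (T := T) huv).sub (by norm_num) (lpOrder_cub (T := T) hu)).const_mul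
    6⁻¹).mono_order (k := 2) (by norm_num)
  have h := ((lpOrder_jump_sub_cubicPoly hμ hF).mono_order (k := 2) (by norm_num)).add (by norm_num)
    (hq.add (by norm_num) hc)
  convert! h using 3 with n z
  have hl : lin p (fun a => emp (cent μ a) n z.1 + displ μ a n z)
      = lin p (fun a => emp (cent μ a) n z.1) + lin p fun a => displ μ a n z := by
    simp [lin, mul_add, Finset.sum_add_distrib]
  unfold cubicPoly
  rw [hl]
  ring

theorem lpOrder_jump (hμ : MemLp (fun x : EuclideanSpace ℝ (Fin d) => x) 8 μ)
    (hF : CubicExpansion μ F p H T) : LpOrder (pairLaw μ) 2 1 (jump F) := by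
  have h := ((lpOrder_jump_sub_lin hμ hF).mono_order (k := 1) (by norm_num)).add (by norm_num)
    ((lpOrder_lin (p := p) (by norm_num) (lpOrder_displ hμ)).mono_exponent (p := 2) (by norm_num))
  simpa using h

/-- The fluctuation of `n` times the bootstrap mean of `F(x̃) - F(x̄)` around its limit. -/
def fluct (μ : Measure (EuclideanSpace ℝ (Fin d))) (H : Fin d → Fin d → ℝ)
    (T : Fin d → Fin d → Fin d → ℝ) (n : ℕ) (x : Fin (n + 1) → EuclideanSpace ℝ (Fin d)) : ℝ :=
  2⁻¹ * (∑ a, ∑ b, H a b * (empCov μ a b n x - M2 μ a b)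
    + ∑ a, ∑ b, ∑ c, T a b c * (emp (cent μ a) n x * M2 μ b c))

theorem lpOrder_fluct (hμ : MemLp (fun x : EuclideanSpace ℝ (Fin d) => x) 8 μ) :
    LpOrder (sampleLaw μ) 4 1 (fluct μ H T) := by
  refine ((LpOrder.sum _ (by norm_num) fun a _ => LpOrder.sum _ (by norm_num) fun b _ =>
    (lpOrder_empCov_sub hμ a b).const_mul _).add (by norm_num)
    (LpOrder.sum _ (by norm_num) fun a _ => LpOrder.sum _ (by norm_num) fun b _ =>
      LpOrder.sum _ (by norm_num) fun c _ => ?_)).const_mul _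
  have h := ((lpOrder_emp_cent hμ a).mono_exponent (p := 4) (by norm_num)).const_mul
    (T a b c * M2 μ b c)
  convert! h using 3
  ring

/-- The first-order fluctuation of the bootstrap mean must be kept, because its correlation with the
linear part of the error contributes at order n⁻². -/
theorem lpOrder_meanJump_sub (hμ : MemLp (fun x : EuclideanSpace ℝ (Fin d) => x) 8 μ)
    (hF : CubicExpansion μ F p H T) (hT : ∀ a b c, T a b c = T b a c)
    (hT' : ∀ a b c, T a b c = T a c b) :
    LpOrder (sampleLaw μ) 2 4 fun n x => meanJump F n x
      - ((n : ℝ) + 1)⁻¹ * (2⁻¹ * ∑ a, ∑ b, H a b * M2 μ a b + fluct μ H T n x) := by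
  have := holderTriple_four
  have h1 := (lpOrder_jump_sub_cubicPoly hμ hF).integral_snd
  have h2 : LpOrder (sampleLaw μ) 2 2 fun n x => 2⁻¹ * ∑ a, ∑ b, ∑ c,
      T a b c * (emp (cent μ a) n x * (empCov μ b c n x - M2 μ b c)) :=
    (LpOrder.sum _ (by norm_num) fun a _ => LpOrder.sum _ (by norm_num) fun b _ =>
      LpOrder.sum _ (by norm_num) fun c _ =>
      (((lpOrder_emp_cent hμ a).mono_exponent (p := 4) (by norm_num)).mul
        (lpOrder_empCov_sub hμ b c)).const_mul _).const_mul _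
  have h3 : LpOrder (sampleLaw μ) 2 0 fun n x => 6⁻¹ * ∑ a, ∑ b, ∑ c,
      T a b c * empThird μ a b c n x :=
    (LpOrder.sum _ (by norm_num) fun a _ => LpOrder.sum _ (by norm_num) fun b _ =>
      LpOrder.sum _ (by norm_num) fun c _ => (lpOrder_empThird hμ a b c).const_mul _).const_mul _
  -- Three remainders of order 4: the averaged quartic one, the product of two order-1 fluctuations
  -- divided by n, and the third empirical moment divided by n².
  have h := h1.add (by norm_num) ((h2.add (by norm_num) h3.inv_mul).inv_mul)
  convert! h using 3 with n x
  rw [integral_sub .of_finite .of_finite, integral_cubicPoly_displ hT hT']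
  simp only [fluct, mul_sub, Finset.sum_sub_distrib]
  rw [meanJump]
  ring

theorem lpOrder_meanJump_sub_const (hμ : MemLp (fun x : EuclideanSpace ℝ (Fin d) => x) 8 μ)
    (hF : CubicExpansion μ F p H T) (hT : ∀ a b c, T a b c = T b a c)
    (hT' : ∀ a b c, T a b c = T a c b) :
    LpOrder (sampleLaw μ) 2 3 fun n x => meanJump F n x
      - ((n : ℝ) + 1)⁻¹ * (2⁻¹ * ∑ a, ∑ b, H a b * M2 μ a b) := by
  have h := ((lpOrder_meanJump_sub hμ hF hT hT').mono_order (k := 3) (by norm_num)).add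
    (by norm_num) ((lpOrder_fluct (H := H) (T := T) hμ).mono_exponent (p := 2) (by norm_num)).inv_mul
  convert! h using 3
  ring

end Expansion

/-! ### Second moments to order n⁻² -/

section Asymptotics

theorem integrable_fun_mul {α : Type*} [MeasurableSpace α] {ν : Measure α} {f g : α → ℝ}
    (hf : MemLp f 2 ν) (hg : MemLp g 2 ν) : Integrable (fun x => f x * g x) ν :=
  hf.integrable_mul hg

theorem IsOrder.mono {k l : ℕ} {r : ℕ → ℝ} (hr : IsOrder l r) (hkl : k ≤ l) : IsOrder k r := by
  obtain ⟨c, hc⟩ := hr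
  refine ⟨|c|, fun n => (hc n).trans ?_⟩
  have := scale_pos n
  calc c * scale n ^ l ≤ |c| * scale n ^ l := by
        gcongr
        exact le_abs_self c
    _ ≤ |c| * scale n ^ k := mul_le_mul_of_nonneg_left
        (pow_le_pow_of_le_one (scale_pos n).le (scale_le_one n) hkl) (abs_nonneg c)

theorem IsOrder.eventually_neg {r : ℕ → ℝ} {a : ℝ} (ha : a < 0) (hr : IsOrder 5 r) :
    ∀ᶠ n : ℕ in Filter.atTop, ((n : ℝ) + 1)⁻¹ * (((n : ℝ) + 1)⁻¹ * a) + r n < 0 := by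
  obtain ⟨c, hc⟩ := hr
  have h : Filter.Tendsto (fun n : ℕ => a + c * scale n) Filter.atTop (nhds (a + c * 0)) :=
    (tendsto_scale.const_mul c).const_add a
  rw [mul_zero, add_zero] at h
  filter_upwards [h.eventually_lt_const ha] with n hn
  rw [← scale_sq]
  have h1 := (abs_le.1 (hc n)).2
  have h2 : 0 < scale n ^ 4 := pow_pos (scale_pos n) 4
  calc scale n ^ 2 * (scale n ^ 2 * a) + r n
      ≤ scale n ^ 2 * (scale n ^ 2 * a) + c * scale n ^ 5 := by linarith
    _ = scale n ^ 4 * (a + c * scale n) := by ring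
    _ < 0 := mul_neg_of_pos_of_neg h2 hn

variable {d : ℕ} {μ : Measure (EuclideanSpace ℝ (Fin d))}
  {F : EuclideanSpace ℝ (Fin d) → ℝ} {p : Fin d → ℝ}
  {H : Fin d → Fin d → ℝ} {T : Fin d → Fin d → Fin d → ℝ}

theorem emp_finsetSum {Ω ι : Type*} (s : Finset ι) (f : ι → Ω → ℝ) (n : ℕ)
    (x : Fin (n + 1) → Ω) : emp (fun x => ∑ a ∈ s, f a x) n x = ∑ a ∈ s, emp (f a) n x := by
  unfold emp
  rw [Finset.sum_comm, Finset.mul_sum]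

theorem emp_const_mul_fun {Ω : Type*} (c : ℝ) (f : Ω → ℝ) (n : ℕ) (x : Fin (n + 1) → Ω) :
    emp (fun x => c * f x) n x = c * emp f n x :=
  emp_const_mul n c fun i => f (x i)

/-- The centred quadratic form `∂²_{ab}F(x⋆) ((x - x⋆)^a (x - x⋆)^b - M₂^{ab})`. -/
def quadDev (μ : Measure (EuclideanSpace ℝ (Fin d))) (H : Fin d → Fin d → ℝ)
    (x : EuclideanSpace ℝ (Fin d)) : ℝ :=
  ∑ a, ∑ b, H a b * (cent μ a x * cent μ b x - M2 μ a b)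

/-- The linear form `∂³_{abc}F(x⋆) (x - x⋆)^a M₂^{bc}`. -/
def cubContract (μ : Measure (EuclideanSpace ℝ (Fin d))) (T : Fin d → Fin d → Fin d → ℝ)
    (x : EuclideanSpace ℝ (Fin d)) : ℝ :=
  ∑ a, ∑ b, ∑ c, T a b c * (cent μ a x * M2 μ b c)

theorem lin_emp_cent (n : ℕ) (x : Fin (n + 1) → EuclideanSpace ℝ (Fin d)) :
    lin p (fun a => emp (cent μ a) n x) = emp (fun x => lin p fun a => cent μ a x) n x := by
  simp only [lin, emp_finsetSum, emp_const_mul_fun]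

/-- Separates averages of i.i.d. centred variables, whose correlation with the linear part is
exactly computable, from a quadratic term of smaller order. -/
theorem fluct_eq (n : ℕ) (x : Fin (n + 1) → EuclideanSpace ℝ (Fin d)) :
    fluct μ H T n x = 2⁻¹ * (emp (quadDev μ H) n x + emp (cubContract μ T) n x
      - quad H fun a => emp (cent μ a) n x) := by
  have h1 : emp (quadDev μ H) n x
      = ∑ a, ∑ b, H a b * emp (fun x => cent μ a x * cent μ b x - M2 μ a b) n x := by
    unfold quadDev
    simp only [emp_finsetSum, emp_const_mul_fun]
  have h2 : emp (cubContract μ T) n x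
      = ∑ a, ∑ b, ∑ c, T a b c * (emp (cent μ a) n x * M2 μ b c) := by
    unfold cubContract
    simp only [mul_comm _ (M2 μ _ _)]
    simp only [emp_finsetSum, emp_const_mul_fun]
  rw [h1, h2]
  simp only [fluct, quad, empCov_sub_eq, mul_sub, Finset.sum_sub_distrib]
  ring

variable [IsProbabilityMeasure μ]

theorem integral_lin_displ_sq (hμ : MemLp (fun x : EuclideanSpace ℝ (Fin d) => x) 8 μ) (n : ℕ) :
    ∫ z, lin p (fun a => displ μ a n z) * lin p (fun a => displ μ a n z) ∂(pairLaw μ n)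
      = ((n : ℝ) + 1)⁻¹ * ∫ x, ∑ a, ∑ b, p a * p b * empCov μ a b n x ∂(sampleLaw μ n) := by
  have hl : MemLp (fun z => lin p fun a => displ μ a n z) 2 (pairLaw μ n) :=
    ((lpOrder_lin (p := p) (by norm_num) (lpOrder_displ hμ)).memLp n).mono_exponent (by norm_num)
  rw [integral_prod _ (integrable_fun_mul hl hl), ← integral_const_mul]
  refine integral_congr_ae (Filter.Eventually.of_forall fun x => ?_)
  have e2 : ∀ a b, ∫ j, displ μ a n (x, j) * displ μ b n (x, j) ∂(resampleLaw n)
      = ((n : ℝ) + 1)⁻¹ * empCov μ a b n x := fun a b =>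
    integral_resample_mul (w' := dev μ b n x) (emp_dev a n x)
  have e : ∀ j, lin p (fun a => displ μ a n (x, j)) * lin p (fun a => displ μ a n (x, j))
      = ∑ a, ∑ b, p a * p b * (displ μ a n (x, j) * displ μ b n (x, j)) := fun j => by
    simp only [lin, Finset.sum_mul_sum]
    refine Finset.sum_congr rfl fun a _ => Finset.sum_congr rfl fun b _ => ?_
    ring
  simp only [e, integral_finsetSum_of_finite, integral_const_mul, e2, Finset.mul_sum]
  refine Finset.sum_congr rfl fun a _ => Finset.sum_congr rfl fun b _ => ?_
  ring

/-- Only the linear part of the increment matters at order 1/n; its mean square is the expected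
empirical covariance contracted with the gradient, divided by n. An error of order 3 suffices, since
this will be divided by K ≥ Cn. -/
theorem isOrder_integral_jump_sq (hμ : MemLp (fun x : EuclideanSpace ℝ (Fin d) => x) 8 μ)
    (hF : CubicExpansion μ F p H T) :
    IsOrder 3 fun n => (∫ z, jump F n z * jump F n z ∂(pairLaw μ n))
      - ((n : ℝ) + 1)⁻¹ * ∑ a, ∑ b, p a * p b * M2 μ a b := by
  have hl := (lpOrder_lin (p := p) (by norm_num) (lpOrder_displ hμ)).mono_exponent (p := 2)
    (by norm_num)
  have hr := lpOrder_jump_sub_lin hμ hF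
  have h1 := (hl.integral_mul hr).const_mul 2
  have h2 := (hr.integral_mul hr).mono (k := 3) (by norm_num)
  have h3 := ((LpOrder.sum (P := sampleLaw μ) (p := 4) Finset.univ (by norm_num) fun a _ =>
    LpOrder.sum Finset.univ (by norm_num) fun b _ =>
    (lpOrder_empCov_sub hμ a b).const_mul (p a * p b)).mono_exponent (p := 1)
      (by norm_num)).integral.inv_mul
  have h := (h1.add h2).add h3
  convert! h using 2 with n
  have il := integrable_fun_mul (hl.memLp n) (hl.memLp n)
  have ilr := integrable_fun_mul (hl.memLp n) (hr.memLp n)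
  have irr := integrable_fun_mul (hr.memLp n) (hr.memLp n)
  have hC : Integrable (fun x => ∑ a, ∑ b, p a * p b * empCov μ a b n x) (sampleLaw μ n) :=
    integrable_finsetSum _ fun a _ => integrable_finsetSum _ fun b _ =>
      (((lpOrder_empCov hμ a b).memLp n).integrable (by norm_num)).const_mul _
  have e : ∀ z, jump F n z * jump F n z
      = (lin p (fun a => displ μ a n z) * lin p (fun a => displ μ a n z)
        + 2 * (lin p (fun a => displ μ a n z) * (jump F n z - lin p fun a => displ μ a n z)))
        + (jump F n z - lin p fun a => displ μ a n z)
          * (jump F n z - lin p fun a => displ μ a n z) := fun z => by ring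
  simp only [e]
  rw [integral_add (il.fun_add (ilr.const_mul 2)) irr, integral_add il (ilr.const_mul 2),
    integral_const_mul, integral_lin_displ_sq hμ]
  simp only [mul_sub, Finset.sum_sub_distrib]
  rw [integral_sub hC (integrable_const _)]
  simp
  ring

theorem isOrder_integral_meanJump_sq (hμ : MemLp (fun x : EuclideanSpace ℝ (Fin d) => x) 8 μ)
    (hF : CubicExpansion μ F p H T) (hT : ∀ a b c, T a b c = T b a c)
    (hT' : ∀ a b c, T a b c = T a c b) :
    IsOrder 5 fun n => (∫ x, meanJump F n x * meanJump F n x ∂(sampleLaw μ n))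
      - ((n : ℝ) + 1)⁻¹ * (((n : ℝ) + 1)⁻¹ * (2⁻¹ * ∑ a, ∑ b, H a b * M2 μ a b) ^ 2) := by
  have hr := lpOrder_meanJump_sub_const hμ hF hT hT'
  set s := 2⁻¹ * ∑ a, ∑ b, H a b * M2 μ a b with hs
  have hc := (LpOrder.const (P := sampleLaw μ) (p := 2) (by norm_num) s).inv_mul
  have h := ((hc.integral_mul hr).const_mul 2).add
    ((hr.integral_mul hr).mono (k := 5) (by norm_num))
  convert! h using 2 with n
  have icc := integrable_fun_mul (hc.memLp n) (hc.memLp n)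
  have icr := integrable_fun_mul (hc.memLp n) (hr.memLp n)
  have irr := integrable_fun_mul (hr.memLp n) (hr.memLp n)
  have e : ∀ x, meanJump F n x * meanJump F n x
      = ((((n : ℝ) + 1)⁻¹ * s) * (((n : ℝ) + 1)⁻¹ * s)
        + 2 * ((((n : ℝ) + 1)⁻¹ * s) * (meanJump F n x - ((n : ℝ) + 1)⁻¹ * s)))
        + (meanJump F n x - ((n : ℝ) + 1)⁻¹ * s) * (meanJump F n x - ((n : ℝ) + 1)⁻¹ * s) :=
    fun x => by ring
  simp only [e]
  rw [integral_add (icc.fun_add (icr.const_mul 2)) irr, integral_add icc (icr.const_mul 2),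
    integral_const_mul 2]
  simp
  ring

theorem memLp_lin_cent (hμ : MemLp (fun x : EuclideanSpace ℝ (Fin d) => x) 8 μ) :
    MemLp (fun x => lin p fun a => cent μ a x) 8 μ :=
  memLp_finsetSum _ fun a _ => (memLp_cent hμ a).const_mul _

theorem integral_lin_cent (hμ : MemLp (fun x : EuclideanSpace ℝ (Fin d) => x) 8 μ) :
    ∫ x, lin p (fun a => cent μ a x) ∂μ = 0 := by
  unfold lin
  rw [integral_finsetSum _ fun a _ =>
    ((memLp_cent hμ a).integrable (by norm_num)).const_mul (p a)]
  simp [integral_const_mul, integral_cent hμ]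

theorem memLp_quadDev (hμ : MemLp (fun x : EuclideanSpace ℝ (Fin d) => x) 8 μ) :
    MemLp (quadDev μ H) 4 μ :=
  memLp_finsetSum _ fun a _ => memLp_finsetSum _ fun b _ => (memLp_cent_mul_sub hμ a b).const_mul _

theorem memLp_cubContract (hμ : MemLp (fun x : EuclideanSpace ℝ (Fin d) => x) 8 μ) :
    MemLp (cubContract μ T) 8 μ :=
  memLp_finsetSum _ fun a _ => memLp_finsetSum _ fun _ _ => memLp_finsetSum _ fun _ _ =>
    ((memLp_cent hμ a).mul_const _).const_mul _

theorem integral_quad_emp_cent (hμ : MemLp (fun x : EuclideanSpace ℝ (Fin d) => x) 8 μ) (n : ℕ) :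
    ∫ x, quad H (fun a => emp (cent μ a) n x) ∂(sampleLaw μ n)
      = ((n : ℝ) + 1)⁻¹ * ∑ a, ∑ b, H a b * M2 μ a b := by
  have hi : ∀ a b, Integrable (fun x => H a b * (emp (cent μ a) n x * emp (cent μ b) n x))
      (sampleLaw μ n) := fun a b =>
    (((lpOrder_emp_cent_mul hμ a b).memLp n).integrable (by norm_num)).const_mul _
  unfold quad
  rw [integral_finsetSum _ fun a _ => integrable_finsetSum _ fun b _ => hi a b, Finset.mul_sum]
  refine Finset.sum_congr rfl fun a _ => ?_
  rw [integral_finsetSum _ fun b _ => hi a b, Finset.mul_sum]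
  refine Finset.sum_congr rfl fun b _ => ?_
  rw [integral_const_mul, integral_emp_mul_emp ((memLp_cent hμ a).mono_exponent (by norm_num))
    ((memLp_cent hμ b).mono_exponent (by norm_num)) (integral_cent hμ a)]
  unfold M2 cent
  ring

/-- The remaining integral of linear times quadratic form is left unevaluated: Hölder gives it order
3, negligible after division by n. -/
theorem integral_lin_mul_fluct (hμ : MemLp (fun x : EuclideanSpace ℝ (Fin d) => x) 8 μ) (n : ℕ) :
    ∫ x, lin p (fun a => emp (cent μ a) n x) * fluct μ H T n x ∂(sampleLaw μ n)
      = 2⁻¹ * (((n : ℝ) + 1)⁻¹ * (∫ x, lin p (fun a => cent μ a x) * quadDev μ H x ∂μ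
        + ∫ x, lin p (fun a => cent μ a x) * cubContract μ T x ∂μ)
        - ∫ x, lin p (fun a => emp (cent μ a) n x) * quad H (fun a => emp (cent μ a) n x)
          ∂(sampleLaw μ n)) := by
  have l2 : MemLp (fun x => lin p fun a => cent μ a x) 2 μ :=
    (memLp_lin_cent hμ).mono_exponent (by norm_num)
  have q2 : MemLp (quadDev μ H) 2 μ := (memLp_quadDev hμ).mono_exponent (by norm_num)
  have c2 : MemLp (cubContract μ T) 2 μ := (memLp_cubContract hμ).mono_exponent (by norm_num)
  have Q2 : MemLp (fun x => quad H fun a => emp (cent μ a) n x) 2 (sampleLaw μ n) :=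
    ((lpOrder_quad (lpOrder_emp_cent hμ)).memLp n).mono_exponent (by norm_num)
  have i1 := integrable_fun_mul (memLp_emp l2 n) (memLp_emp q2 n)
  have i2 := integrable_fun_mul (memLp_emp l2 n) (memLp_emp c2 n)
  have i3 := integrable_fun_mul (memLp_emp l2 n) Q2
  simp only [fluct_eq, lin_emp_cent]
  have e : ∀ x, emp (fun x => lin p fun a => cent μ a x) n x
      * (2⁻¹ * (emp (quadDev μ H) n x + emp (cubContract μ T) n x
        - quad H fun a => emp (cent μ a) n x))
      = 2⁻¹ * ((emp (fun x => lin p fun a => cent μ a x) n x * emp (quadDev μ H) n x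
        + emp (fun x => lin p fun a => cent μ a x) n x * emp (cubContract μ T) n x)
        - emp (fun x => lin p fun a => cent μ a x) n x
          * quad H fun a => emp (cent μ a) n x) := fun x => by ring
  simp only [e]
  rw [integral_const_mul, integral_sub (i1.fun_add i2) i3, integral_add i1 i2,
    integral_emp_mul_emp l2 q2 (integral_lin_cent hμ),
    integral_emp_mul_emp l2 c2 (integral_lin_cent hμ)]
  ring

/-- Two contributions survive at n⁻²: the bias of the quadratic part of the error times the limiting
bootstrap bias, and the covariance of the linear part with `fluct`. -/
theorem isOrder_integral_err_mul_meanJump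
    (hμ : MemLp (fun x : EuclideanSpace ℝ (Fin d) => x) 8 μ)
    (hF : CubicExpansion μ F p H T) (hT : ∀ a b c, T a b c = T b a c)
    (hT' : ∀ a b c, T a b c = T a c b) :
    IsOrder 5 fun n => (∫ x, err μ F n x * meanJump F n x ∂(sampleLaw μ n))
      - ((n : ℝ) + 1)⁻¹ * (((n : ℝ) + 1)⁻¹ * ((2⁻¹ * ∑ a, ∑ b, H a b * M2 μ a b) ^ 2
        + 2⁻¹ * (∫ x, lin p (fun a => cent μ a x) * quadDev μ H x ∂μ
          + ∫ x, lin p (fun a => cent μ a x) * cubContract μ T x ∂μ))) := by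
  have hA := lpOrder_err_sub hμ hF
  have hm3 := lpOrder_meanJump_sub_const hμ hF hT hT'
  have hm4 := lpOrder_meanJump_sub hμ hF hT hT'
  set s := 2⁻¹ * ∑ a, ∑ b, H a b * M2 μ a b with hs
  have hc := (LpOrder.const (P := sampleLaw μ) (p := 2) (by norm_num) s).inv_mul
  have hm : LpOrder (sampleLaw μ) 2 2 (meanJump F) := by
    simpa using (hm3.mono_order (k := 2) (by norm_num)).add (by norm_num) hc
  have hl := (lpOrder_lin (p := p) (by norm_num) (lpOrder_emp_cent hμ)).mono_exponent
    (p := 2) (by norm_num)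
  have hq := (lpOrder_quad (H := H) (lpOrder_emp_cent hμ)).mono_exponent (p := 2) (by norm_num)
  have hf := (lpOrder_fluct (H := H) (T := T) hμ).mono_exponent (p := 2) (by norm_num)
  have h := ((hA.integral_mul hm).add ((hq.integral_mul hm3).const_mul 2⁻¹)).add
    ((hl.integral_mul hm4).sub ((hl.integral_mul hq).inv_mul.const_mul 2⁻¹))
  convert! h using 2 with n
  have i1 := integrable_fun_mul (hA.memLp n) (hm.memLp n)
  have i2 := (integrable_fun_mul (hq.memLp n) (hm3.memLp n)).const_mul 2⁻¹
  have i3 := integrable_fun_mul (hl.memLp n) (hm4.memLp n)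
  have i4 := (integrable_fun_mul (hl.memLp n) (hf.memLp n)).const_mul ((n : ℝ) + 1)⁻¹
  have i5 := ((hl.memLp n).integrable one_le_two).const_mul (((n : ℝ) + 1)⁻¹ * s)
  have i6 := ((hq.memLp n).integrable one_le_two).const_mul (((n : ℝ) + 1)⁻¹ * s * 2⁻¹)
  -- The first three products have orders 3 + 2, 2 + 3 and 1 + 4. The fourth gives the covariances,
  -- the fifth has mean zero, and the sixth gives s²/n².
  have e : ∀ x, err μ F n x * meanJump F n x =
      (err μ F n x - (lin p (fun a => emp (cent μ a) n x)
        + 2⁻¹ * quad H fun a => emp (cent μ a) n x)) * meanJump F n x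
      + 2⁻¹ * (quad H (fun a => emp (cent μ a) n x)
        * (meanJump F n x - ((n : ℝ) + 1)⁻¹ * s))
      + lin p (fun a => emp (cent μ a) n x)
        * (meanJump F n x - ((n : ℝ) + 1)⁻¹ * (s + fluct μ H T n x))
      + ((n : ℝ) + 1)⁻¹ * (lin p (fun a => emp (cent μ a) n x) * fluct μ H T n x)
      + (((n : ℝ) + 1)⁻¹ * s) * lin p (fun a => emp (cent μ a) n x)
      + (((n : ℝ) + 1)⁻¹ * s * 2⁻¹) * quad H (fun a => emp (cent μ a) n x) := fun x => by ring
  have hl0 : ∫ x, lin p (fun a => emp (cent μ a) n x) ∂(sampleLaw μ n) = 0 := by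
    simp only [lin_emp_cent]
    rw [integral_emp ((memLp_lin_cent hμ).integrable (by norm_num)), integral_lin_cent hμ]
  simp only [e]
  rw [integral_add ((((i1.fun_add i2).fun_add i3).fun_add i4).fun_add i5) i6,
    integral_add (((i1.fun_add i2).fun_add i3).fun_add i4) i5,
    integral_add ((i1.fun_add i2).fun_add i3) i4, integral_add (i1.fun_add i2) i3,
    integral_add i1 i2, integral_const_mul 2⁻¹, integral_const_mul ((n : ℝ) + 1)⁻¹,
    integral_const_mul (((n : ℝ) + 1)⁻¹ * s), integral_const_mul (((n : ℝ) + 1)⁻¹ * s * 2⁻¹), hl0,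
    integral_lin_mul_fluct hμ, integral_quad_emp_cent hμ]
  have hs' : ∑ a, ∑ b, H a b * M2 μ a b = 2 * s := by rw [hs]; ring
  rw [hs']
  ring

end Asymptotics

/-! ### Cauchy–Schwarz in integral form -/

section CauchySchwarz

theorem sq_integral_mul_le {α : Type*} [MeasurableSpace α] {ν : Measure α} {f g : α → ℝ}
    (hf : MemLp f 2 ν) (hg : MemLp g 2 ν) :
    (∫ x, f x * g x ∂ν) ^ 2 ≤ (∫ x, f x ^ 2 ∂ν) * ∫ x, g x ^ 2 ∂ν := by
  have h1 : |∫ x, f x * g x ∂ν| ≤ lpNorm f 2 ν * lpNorm g 2 ν := by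
    refine le_trans ?_ (lpNorm_mul_le (r := 1) hf hg)
    have hm : AEStronglyMeasurable (fun x => f x * g x) ν := hf.1.mul hg.1
    rw [lpNorm_one_eq_integral_norm hm]
    exact norm_integral_le_integral_norm (fun x => f x * g x)
  have hf2 : lpNorm f 2 ν ^ 2 = ∫ x, f x ^ 2 ∂ν := by
    simpa using lpNorm_pow_two_mul (m := 1) one_ne_zero (by simpa using hf)
  have hg2 : lpNorm g 2 ν ^ 2 = ∫ x, g x ^ 2 ∂ν := by
    simpa using lpNorm_pow_two_mul (m := 1) one_ne_zero (by simpa using hg)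
  rw [← hf2, ← hg2, ← mul_pow, ← sq_abs]
  exact pow_le_pow_left₀ (abs_nonneg _) h1 2

end CauchySchwarz

/-! ### The σ's as integrals and the sign of the leading coefficient -/

section MomentTensors

variable {d : ℕ} {μ : Measure (EuclideanSpace ℝ (Fin d))} [IsProbabilityMeasure μ]
  {p : Fin d → ℝ} {H : Fin d → Fin d → ℝ} {T : Fin d → Fin d → Fin d → ℝ}

theorem sum_M2_eq_integral_lin_sq (hμ : MemLp (fun x : EuclideanSpace ℝ (Fin d) => x) 8 μ) :
    ∑ a, ∑ b, p a * p b * M2 μ a b = ∫ x, lin p (fun a => cent μ a x) ^ 2 ∂μ := by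
  have hi : ∀ a b, Integrable (fun x => p a * p b * (cent μ a x * cent μ b x)) μ := fun a b =>
    ((memLp_cent_mul hμ a b).integrable (by norm_num)).const_mul _
  have e : ∀ x, lin p (fun a => cent μ a x) ^ 2
      = ∑ a, ∑ b, p a * p b * (cent μ a x * cent μ b x) := fun x => by
    simp only [lin, sq, Finset.sum_mul_sum]
    refine Finset.sum_congr rfl fun a _ => Finset.sum_congr rfl fun b _ => ?_
    ring
  simp only [e]
  rw [integral_finsetSum _ fun a _ => integrable_finsetSum _ fun b _ => hi a b]
  refine Finset.sum_congr rfl fun a _ => ?_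
  rw [integral_finsetSum _ fun b _ => hi a b]
  exact Finset.sum_congr rfl fun b _ => (integral_const_mul _ _).symm

theorem sum_M2_eq_integral_quad (hμ : MemLp (fun x : EuclideanSpace ℝ (Fin d) => x) 8 μ) :
    ∑ a, ∑ b, H a b * M2 μ a b = ∫ x, quad H (fun a => cent μ a x) ∂μ := by
  have hi : ∀ a b, Integrable (fun x => H a b * (cent μ a x * cent μ b x)) μ := fun a b =>
    ((memLp_cent_mul hμ a b).integrable (by norm_num)).const_mul _
  unfold quad
  rw [integral_finsetSum _ fun a _ => integrable_finsetSum _ fun b _ => hi a b]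
  refine Finset.sum_congr rfl fun a _ => ?_
  rw [integral_finsetSum _ fun b _ => hi a b]
  exact Finset.sum_congr rfl fun b _ => (integral_const_mul _ _).symm

theorem sum_M2_M2_eq_integral_lin_mul_cubContract
    (hμ : MemLp (fun x : EuclideanSpace ℝ (Fin d) => x) 8 μ) :
    ∑ a, ∑ b, ∑ c, ∑ e, p a * M2 μ a b * T b c e * M2 μ c e
      = ∫ x, lin p (fun a => cent μ a x) * cubContract μ T x ∂μ := by
  have hi : ∀ a b c e, Integrable
      (fun x => p a * T b c e * M2 μ c e * (cent μ a x * cent μ b x)) μ := fun a b c e =>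
    ((memLp_cent_mul hμ a b).integrable (by norm_num)).const_mul _
  have e : ∀ x, lin p (fun a => cent μ a x) * cubContract μ T x
      = ∑ a, ∑ b, ∑ c, ∑ e, p a * T b c e * M2 μ c e * (cent μ a x * cent μ b x) := fun x => by
    simp only [lin, cubContract, Finset.sum_mul_sum]
    refine Finset.sum_congr rfl fun a _ => Finset.sum_congr rfl fun b _ => ?_
    simp only [Finset.mul_sum]
    refine Finset.sum_congr rfl fun c _ => Finset.sum_congr rfl fun e _ => ?_
    ring
  simp only [e]
  rw [integral_finsetSum _ fun a _ => integrable_finsetSum _ fun b _ =>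
    integrable_finsetSum _ fun c _ => integrable_finsetSum _ fun e _ => hi a b c e]
  refine Finset.sum_congr rfl fun a _ => ?_
  rw [integral_finsetSum _ fun b _ =>
    integrable_finsetSum _ fun c _ => integrable_finsetSum _ fun e _ => hi a b c e]
  refine Finset.sum_congr rfl fun b _ => ?_
  rw [integral_finsetSum _ fun c _ => integrable_finsetSum _ fun e _ => hi a b c e]
  refine Finset.sum_congr rfl fun c _ => ?_
  rw [integral_finsetSum _ fun e _ => hi a b c e]
  refine Finset.sum_congr rfl fun e _ => ?_
  rw [integral_const_mul]
  unfold M2 cent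
  ring

theorem sum_M4_eq_integral_quad_sq (hμ : MemLp (fun x : EuclideanSpace ℝ (Fin d) => x) 8 μ) :
    ∑ a, ∑ b, ∑ c, ∑ e, H a b * H c e * M4 μ a b c e
      = ∫ x, quad H (fun a => cent μ a x) ^ 2 ∂μ := by
  have hi : ∀ a b c e, Integrable (fun x => H a b * H c e
      * (cent μ a x * cent μ b x * cent μ c x * cent μ e x)) μ := fun a b c e => by
    have h := integrable_fun_mul ((memLp_cent_mul hμ a b).mono_exponent (p := 2) (by norm_num))
      ((memLp_cent_mul hμ c e).mono_exponent (p := 2) (by norm_num))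
    simp only [← mul_assoc] at h
    exact h.const_mul _
  have e : ∀ x, quad H (fun a => cent μ a x) ^ 2 = ∑ a, ∑ b, ∑ c, ∑ e, H a b * H c e
      * (cent μ a x * cent μ b x * cent μ c x * cent μ e x) := fun x => by
    simp only [quad, sq, Finset.sum_mul, Finset.mul_sum]
    refine Finset.sum_congr rfl fun a _ => Finset.sum_congr rfl fun b _ =>
      Finset.sum_congr rfl fun c _ => Finset.sum_congr rfl fun e _ => ?_
    ring
  simp only [e]
  rw [integral_finsetSum _ fun a _ => integrable_finsetSum _ fun b _ =>
    integrable_finsetSum _ fun c _ => integrable_finsetSum _ fun e _ => hi a b c e]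
  refine Finset.sum_congr rfl fun a _ => ?_
  rw [integral_finsetSum _ fun b _ =>
    integrable_finsetSum _ fun c _ => integrable_finsetSum _ fun e _ => hi a b c e]
  refine Finset.sum_congr rfl fun b _ => ?_
  rw [integral_finsetSum _ fun c _ => integrable_finsetSum _ fun e _ => hi a b c e]
  refine Finset.sum_congr rfl fun c _ => ?_
  rw [integral_finsetSum _ fun e _ => hi a b c e]
  exact Finset.sum_congr rfl fun e _ => (integral_const_mul _ _).symm

/-- This is the variance of the quadratic form. The subtracted square is what later makes a
non-strict assumption yield a strict inequality. -/
theorem integral_quadDev_sq (hμ : MemLp (fun x : EuclideanSpace ℝ (Fin d) => x) 8 μ) :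
    ∫ x, quadDev μ H x ^ 2 ∂μ = (∑ a, ∑ b, ∑ c, ∑ e, H a b * H c e * M4 μ a b c e)
      - (∑ a, ∑ b, H a b * M2 μ a b) ^ 2 := by
  have hq : MemLp (fun x => quad H fun a => cent μ a x) 2 μ :=
    MemLp.mono_exponent (q := 4) (memLp_finsetSum _ fun a _ => memLp_finsetSum _ fun b _ =>
      (memLp_cent_mul hμ a b).const_mul _) (by norm_num)
  have hv := variance_eq_sub hq
  rw [variance_eq_integral hq.1.aemeasurable, ← sum_M2_eq_integral_quad hμ] at hv
  have e : ∀ x, quadDev μ H x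
      = quad H (fun a => cent μ a x) - ∑ a, ∑ b, H a b * M2 μ a b := fun x => by
    simp [quadDev, quad, mul_sub, Finset.sum_sub_distrib]
  simp only [e, sum_M4_eq_integral_quad_sq hμ]
  exact hv

/-- Cauchy–Schwarz against the linear form bounds both the covariance m and s₃ in terms of s₁. -/
theorem leading_coeff_neg (hμ : MemLp (fun x : EuclideanSpace ℝ (Fin d) => x) 8 μ)
    {C s₁ s₂ s₃ s₄ : ℝ} (hs₁ : s₁ = ∑ a, ∑ b, p a * p b * M2 μ a b)
    (hs₂ : s₂ = ∑ a, ∑ b, H a b * M2 μ a b)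
    (hs₃ : s₃ = ∑ a, ∑ b, ∑ c, ∑ e, p a * M2 μ a b * T b c e * M2 μ c e)
    (hs₄ : s₄ = ∑ a, ∑ b, ∑ c, ∑ e, H a b * H c e * M4 μ a b c e)
    (hne : s₂ ≠ 0) (h : s₁ / C + √(s₁ * s₄) - s₃ ≤ s₂ ^ 2 / 4) :
    s₁ / C - ∫ x, lin p (fun a => cent μ a x) * quadDev μ H x ∂μ - s₃ - s₂ ^ 2 / 4 < 0 := by
  have l2 : MemLp (fun x => lin p fun a => cent μ a x) 2 μ :=
    (memLp_lin_cent hμ).mono_exponent (by norm_num)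
  have q2 : MemLp (quadDev μ H) 2 μ := (memLp_quadDev hμ).mono_exponent (by norm_num)
  have c2 : MemLp (cubContract μ T) 2 μ := (memLp_cubContract hμ).mono_exponent (by norm_num)
  have hm := sq_integral_mul_le l2 q2
  have h3 := sq_integral_mul_le l2 c2
  rw [← sum_M2_eq_integral_lin_sq hμ, ← hs₁] at hm h3
  rw [← sum_M2_M2_eq_integral_lin_mul_cubContract hμ, ← hs₃] at h3
  rw [integral_quadDev_sq hμ, ← hs₄, ← hs₂] at hm
  set m := ∫ x, lin p (fun a => cent μ a x) * quadDev μ H x ∂μ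
  have h0 : 0 ≤ s₁ := by
    rw [hs₁, sum_M2_eq_integral_lin_sq hμ]
    exact integral_nonneg fun x => sq_nonneg _
  have hs2 : 0 < s₂ ^ 2 := by positivity
  -- If s₁ = 0, the linear form vanishes almost everywhere, which kills m and s₃. Otherwise m² ≤
  -- s₁(s₄ − s₂²) < s₁s₄.
  rcases h0.eq_or_lt with h0 | h0
  · rw [← h0, zero_mul] at hm h3
    have hm0 : m = 0 := by nlinarith
    have h30 : s₃ = 0 := by nlinarith
    rw [← h0, hm0, h30, zero_div]
    linarith
  · have hlt : m ^ 2 < s₁ * s₄ := by nlinarith [mul_pos h0 hs2]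
    have := (Real.lt_sqrt (abs_nonneg m)).2 (by rwa [sq_abs])
    linarith [neg_abs_le m]

end MomentTensors

/-! ### Integrating out the bootstrap -/

section Joint

/-- Bias–variance decomposition for an average of K independent copies, with the squared mean
dropped from the variance. -/
theorem integral_sub_average_sq_le {α : Type*} [Finite α] [MeasurableSpace α]
    [DiscreteMeasurableSpace α] {ν : Measure α} [IsProbabilityMeasure ν] (W : α → ℝ) (e : ℝ) {K : ℕ}
    (hK : 0 < K) :
    ∫ J, (e - (K : ℝ)⁻¹ * ∑ k, W (J k)) ^ 2 ∂(Measure.pi fun _ : Fin K => ν)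
      ≤ (e - ∫ j, W j ∂ν) ^ 2 + (K : ℝ)⁻¹ * ∫ j, W j * W j ∂ν := by
  have hK' : (K : ℝ) ≠ 0 := by positivity
  set g := ∫ j, W j ∂ν with hg
  set f : α → ℝ := fun j => W j - g with hf
  have hf0 : ∫ j, f j ∂ν = 0 := by
    simp only [hf]
    rw [integral_sub .of_finite .of_finite]
    simp [← hg]
  have hff : ∫ j, f j * f j ∂ν = ∫ j, W j * W j ∂ν - g ^ 2 := by
    have e1 : ∀ j, f j * f j = W j * W j - (2 * g * W j - g ^ 2) := fun j => by
      simp only [hf]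
      ring
    simp only [e1]
    rw [integral_sub .of_finite .of_finite, integral_sub .of_finite .of_finite, integral_const_mul,
      ← hg]
    simp
    ring
  have e2 : ∀ J : Fin K → α, (e - (K : ℝ)⁻¹ * ∑ k, W (J k)) ^ 2
      = ((e - g) ^ 2 + (-2 * (e - g) * (K : ℝ)⁻¹) * ∑ k, f (J k))
        + (K : ℝ)⁻¹ ^ 2 * ((∑ k, f (J k)) * ∑ k, f (J k)) := fun J => by
    have : (K : ℝ)⁻¹ * ∑ k, W (J k) = g + (K : ℝ)⁻¹ * ∑ k, f (J k) := by
      simp only [hf, Finset.sum_sub_distrib, Finset.sum_const, Finset.card_univ, Fintype.card_fin,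
        nsmul_eq_mul]
      field_simp
      ring
    rw [this]
    ring
  simp only [e2, integral_add_of_finite, integral_const_mul]
  rw [integral_sum_coord .of_finite, integral_sum_mul_sum MemLp.of_discrete MemLp.of_discrete hf0,
    hf0, hff]
  simp only [integral_const, probReal_univ, smul_eq_mul, one_mul, mul_zero, add_zero]
  have : (K : ℝ)⁻¹ ^ 2 * (K * (∫ j, W j * W j ∂ν - g ^ 2))
      = (K : ℝ)⁻¹ * ∫ j, W j * W j ∂ν - (K : ℝ)⁻¹ * g ^ 2 := by
    field_simp
  rw [this]
  have : 0 ≤ (K : ℝ)⁻¹ * g ^ 2 := by positivity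
  linarith

variable {d : ℕ} {μ : Measure (EuclideanSpace ℝ (Fin d))} {F : EuclideanSpace ℝ (Fin d) → ℝ}

theorem err_add_shift {n K : ℕ} (hK : 0 < K) (x : Fin (n + 1) → EuclideanSpace ℝ (Fin d))
    (J : Fin K → Fin (n + 1) → Fin (n + 1)) :
    F (avg x) + shift F x J - F (mean μ) = err μ F n x - (K : ℝ)⁻¹ * ∑ k, jump F n (x, J k) := by
  have hK' : (K : ℝ) ≠ 0 := by positivity
  simp only [shift, err, jump, Finset.sum_sub_distrib, Finset.sum_const, Finset.card_univ,
    Fintype.card_fin, nsmul_eq_mul]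
  field_simp
  ring

variable [IsProbabilityMeasure μ]

theorem memLp_err_add_shift {n K : ℕ} (hK : 0 < K) (he : MemLp (err μ F n) 2 (sampleLaw μ n))
    (hj : MemLp (jump F n) 2 (pairLaw μ n)) :
    MemLp (fun ω => F (avg ω.1) + shift F ω.1 ω.2 - F (mean μ)) 2 (jointLaw μ (n + 1) K) := by
  simp only [err_add_shift hK]
  have hprod : jointLaw μ (n + 1) K
      = (sampleLaw μ n).prod (Measure.pi fun _ : Fin K => resampleLaw n) := rfl
  rw [hprod]
  have h1 := he.comp_fst (Measure.pi fun _ : Fin K => resampleLaw n)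
  have h2 : ∀ k : Fin K, MemLp (fun ω => jump F n (ω.1, ω.2 k)) 2
      ((sampleLaw μ n).prod (Measure.pi fun _ : Fin K => resampleLaw n)) := fun k => by
    have hev : MeasurePreserving (fun J : Fin K → Fin (n + 1) → Fin (n + 1) => J k)
        (Measure.pi fun _ : Fin K => resampleLaw n) (resampleLaw n) :=
      measurePreserving_eval (fun _ : Fin K => resampleLaw n) k
    exact hj.comp_measurePreserving ((MeasurePreserving.id (sampleLaw μ n)).prod hev)
  exact h1.sub ((memLp_finsetSum _ fun k _ => h2 k).const_mul _)

/-- Apply the conditional bound for each fixed sample, then integrate over the sample by Fubini. -/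
theorem integral_err_add_shift_sq_le {n K : ℕ} (hK : 0 < K)
    (he : MemLp (err μ F n) 2 (sampleLaw μ n)) (hj : MemLp (jump F n) 2 (pairLaw μ n))
    (hm : MemLp (meanJump F n) 2 (sampleLaw μ n)) :
    ∫ ω, (F (avg ω.1) + shift F ω.1 ω.2 - F (mean μ)) ^ 2 ∂(jointLaw μ (n + 1) K)
      ≤ ∫ x, err μ F n x ^ 2 ∂(sampleLaw μ n)
        - 2 * ∫ x, err μ F n x * meanJump F n x ∂(sampleLaw μ n)
        + ∫ x, meanJump F n x * meanJump F n x ∂(sampleLaw μ n)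
        + (K : ℝ)⁻¹ * ∫ z, jump F n z * jump F n z ∂(pairLaw μ n) := by
  have hs := (memLp_err_add_shift hK he hj).integrable_sq
  have hjj := integrable_fun_mul hj hj
  have iee := he.integrable_sq
  have iem := (integrable_fun_mul he hm).const_mul 2
  have imm := integrable_fun_mul hm hm
  have isub : Integrable (fun x => err μ F n x ^ 2 - 2 * (err μ F n x * meanJump F n x))
      (sampleLaw μ n) := iee.sub iem
  have ij : Integrable (fun x => (K : ℝ)⁻¹ * ∫ j, jump F n (x, j) * jump F n (x, j)
      ∂(resampleLaw n)) (sampleLaw μ n) := hjj.integral_prod_left.const_mul _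
  have e1 : ∀ x, (err μ F n x - meanJump F n x) ^ 2
      + (K : ℝ)⁻¹ * ∫ j, jump F n (x, j) * jump F n (x, j) ∂(resampleLaw n)
      = err μ F n x ^ 2 - 2 * (err μ F n x * meanJump F n x) + meanJump F n x * meanJump F n x
      + (K : ℝ)⁻¹ * ∫ j, jump F n (x, j) * jump F n (x, j) ∂(resampleLaw n) := fun x => by ring
  have iR : Integrable (fun x => (err μ F n x - meanJump F n x) ^ 2
      + (K : ℝ)⁻¹ * ∫ j, jump F n (x, j) * jump F n (x, j) ∂(resampleLaw n)) (sampleLaw μ n) := by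
    simp only [e1]
    exact (isub.add imm).add ij
  have hle : ∫ ω, (F (avg ω.1) + shift F ω.1 ω.2 - F (mean μ)) ^ 2 ∂(jointLaw μ (n + 1) K)
      ≤ ∫ x, ((err μ F n x - meanJump F n x) ^ 2
        + (K : ℝ)⁻¹ * ∫ j, jump F n (x, j) * jump F n (x, j) ∂(resampleLaw n))
          ∂(sampleLaw μ n) := by
    have hprod : jointLaw μ (n + 1) K
        = (sampleLaw μ n).prod (Measure.pi fun _ : Fin K => resampleLaw n) := rfl
    rw [hprod] at hs ⊢
    rw [integral_prod _ hs]
    refine integral_mono hs.integral_prod_left iR fun x => ?_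
    simp only [err_add_shift hK]
    exact integral_sub_average_sq_le (fun j => jump F n (x, j)) (err μ F n x) hK
  refine hle.trans (le_of_eq ?_)
  simp only [e1]
  rw [integral_add (isub.fun_add imm) ij, integral_add isub imm,
    integral_sub iee iem, integral_const_mul, integral_const_mul, integral_prod _ hjj]

end Joint

end BootstrapShift

end

/-! ### The main theorem -/

open BootstrapShift

theorem theorem1 {d : ℕ} (μ : Measure (EuclideanSpace ℝ (Fin d))) [IsProbabilityMeasure μ]
    (F : EuclideanSpace ℝ (Fin d) → ℝ)
    (hμ : MemLp (fun x : EuclideanSpace ℝ (Fin d) => x) 8 μ)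
    (hconv : ConvexOn ℝ Set.univ F)
    (hF3 : ContDiff ℝ 3 F)
    (hF4 : Differentiable ℝ (iteratedFDeriv ℝ 3 F))
    (hB : ∃ B : ℝ, ∀ x, ‖iteratedFDeriv ℝ 4 F x‖ ≤ B)
    (hne : BootstrapShift.sigma2 μ F ≠ 0)
    (C : ℝ) (hC : 0 < C)
    (hcond : BootstrapShift.sigma1 μ F / C
        + Real.sqrt (BootstrapShift.sigma1 μ F * BootstrapShift.sigma4 μ F)
        - BootstrapShift.sigma3 μ F ≤ BootstrapShift.sigma2 μ F ^ 2 / 4) :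
    ∃ N : ℕ, ∀ n : ℕ, N ≤ n → ∀ K : ℕ, C * (n : ℝ) ≤ (K : ℝ) →
      Integrable (fun ω => (F (BootstrapShift.avg ω.1) + BootstrapShift.shift F ω.1 ω.2
          - F (BootstrapShift.mean μ)) ^ 2) (BootstrapShift.jointLaw μ n K) ∧
      Integrable (fun ω => (F (BootstrapShift.avg ω.1) - F (BootstrapShift.mean μ)) ^ 2)
        (BootstrapShift.jointLaw μ n K) ∧
      ∫ ω, (F (BootstrapShift.avg ω.1) + BootstrapShift.shift F ω.1 ω.2
          - F (BootstrapShift.mean μ)) ^ 2 ∂(BootstrapShift.jointLaw μ n K)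
        < ∫ ω, (F (BootstrapShift.avg ω.1) - F (BootstrapShift.mean μ)) ^ 2
            ∂(BootstrapShift.jointLaw μ n K) := by
  set p : Fin d → ℝ := fun a => pd F (mean μ) ![a] with hp
  set H : Fin d → Fin d → ℝ := fun a b => pd F (mean μ) ![a, b] with hH
  set T : Fin d → Fin d → Fin d → ℝ := fun a b c => pd F (mean μ) ![a, b, c] with hTdef
  have hT : ∀ a b c, T a b c = T b a c := pd_three_swap_left hF3 (mean μ)
  have hT' : ∀ a b c, T a b c = T a c b := pd_three_swap_right hF3 (mean μ)
  have hF : CubicExpansion μ F p H T := by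
    refine ⟨hF3.continuous, ?_⟩
    obtain ⟨B, hB⟩ := exists_cubic_expansion hF3 hF4 hB (mean μ)
    refine ⟨B, fun h => le_of_eq_of_le ?_ (hB h)⟩
    congr 1
    unfold cubicPoly lin quad cub
    ring
  have hneg := leading_coeff_neg (p := p) (H := H) (T := T) hμ (C := C) (s₁ := sigma1 μ F)
    (s₂ := sigma2 μ F) (s₃ := sigma3 μ F) (s₄ := sigma4 μ F) rfl rfl rfl rfl hne hcond
  have hs₃ : sigma3 μ F = ∫ x, lin p (fun a => cent μ a x) * cubContract μ T x ∂μ :=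
    sum_M2_M2_eq_integral_lin_mul_cubContract hμ
  have o1 := isOrder_integral_err_mul_meanJump hμ hF hT hT'
  have o2 := isOrder_integral_meanJump_sq hμ hF hT hT'
  have o3 := isOrder_integral_jump_sq hμ hF
  -- The weights −2, 1 and 1/(C(n + 1)) are those in the bound on the change of the mean squared
  -- error, with 1/K replaced by its upper bound.
  have hord := ((o1.const_mul (-2)).add o2).add (o3.inv_mul.const_mul C⁻¹)
  obtain ⟨N, hN⟩ := Filter.eventually_atTop.1 (hord.eventually_neg hneg)
  -- The shift by one matches the convention that index n stands for sample size n + 1.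
  refine ⟨N + 1, fun n hn K hK => ?_⟩
  obtain ⟨n, rfl⟩ : ∃ m, n = m + 1 := ⟨n - 1, by omega⟩
  have hK0 : 0 < K := by
    have : 0 < C * ((n + 1 : ℕ) : ℝ) := by positivity
    exact_mod_cast this.trans_le hK
  have he := (lpOrder_err hμ hF).memLp n
  have hj := (lpOrder_jump hμ hF).memLp n
  have hm : MemLp (meanJump F n) 2 (sampleLaw μ n) :=
    (lpOrder_jump hμ hF).integral_snd.memLp n
  have hfst : MeasurePreserving Prod.fst (jointLaw μ (n + 1) K) (sampleLaw μ n) :=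
    measurePreserving_fst (μ := sampleLaw μ n) (ν := Measure.pi fun _ : Fin K => resampleLaw n)
  refine ⟨(memLp_err_add_shift hK0 he hj).integrable_sq,
    (he.comp_measurePreserving hfst).integrable_sq, ?_⟩
  have hbefore : ∫ ω, (F (avg ω.1) - F (mean μ)) ^ 2 ∂(jointLaw μ (n + 1) K)
      = ∫ x, err μ F n x ^ 2 ∂(sampleLaw μ n) := by
    rw [← hfst.map_eq, integral_map hfst.measurable.aemeasurable
      (hfst.map_eq.symm ▸ he.1.pow 2)]
    rfl
  rw [hbefore]
  refine (integral_err_add_shift_sq_le hK0 he hj hm).trans_lt ?_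
  have hlt := hN n (by omega)
  have hs₁ : ∑ a, ∑ b, p a * p b * M2 μ a b = sigma1 μ F := rfl
  have hs₂ : ∑ a, ∑ b, H a b * M2 μ a b = sigma2 μ F := rfl
  rw [hs₁, hs₂, ← hs₃] at hlt
  have hKC : (K : ℝ)⁻¹ ≤ C⁻¹ * ((n : ℝ) + 1)⁻¹ := by
    rw [← mul_inv]
    push_cast at hK
    exact inv_anti₀ (by positivity) hK
  have hjj : 0 ≤ ∫ z, jump F n z * jump F n z ∂(pairLaw μ n) :=
    integral_nonneg fun z => mul_self_nonneg _
  have hle := mul_le_mul_of_nonneg_right hKC hjj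
  -- The quantity in `hlt` is the leading term plus the deviations from it, hence exactly −2𝔼(eG) +
  -- 𝔼G² + 𝔼J²/(C(n + 1)); `hle` compares this with the 1/K version.
  refine lt_of_sub_neg (lt_of_le_of_lt ?_ hlt)
  rw [div_eq_mul_inv (sigma1 μ F)]
  linarith
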